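/- **Setting.** Consider $x[t+1]=Ax[t]$, $y_i[t]=C_ix[t]+e_i[t]$, $t\in\mathbb N$, with $A\in\mathbb R^{n\times n}$ and one scalar sensor at each node $i\in P=\{1,\dots,p\}$; $C\in\mathbb R^{p\times n}$ has rows $C_i$. An adversary attacks a fixed, unknown set of at most $s$ sensors: $e_i\equiv 0$ for the other sensors, and $e_i$ is arbitrary for the attacked ones; attacked nodes still execute their algorithm correctly. All nodes know the system and the network. The network is a connected, time-invariant, undirected graph with symmetric weights $a_{ij}$, $a_{ij}>0$ if $ij$ is an edge and $a_{ij}=0$ otherwise, and Laplacian $\mathcal L$. Assume that for every eigenvalue $\mu=m+\mathbf i\,q$ of $A$ with $|\mu|\ge 1$ and every non-zero eigenvalue $\lambda$ of $\mathcal L$, $$\Bigl(m-\tfrac{\lambda^2}{\lambda_{\max}(\mathcal L)^2}\Bigr)^2+q^2<1;$$ if $p=1$ (where this is void) assume instead $(m-1)^2+q^2<1$ for every such $\mu$. **Detectability.** $(A,C)$ is detectable if every eigenvalue of $A$ having an eigenvector in $\ker C$ has modulus $<1$. It is $k$-sparse detectable if $(A,C_K)$ is detectable for all $K\subseteq P$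 with $|K|\ge p-k$, where $C_K$ keeps the rows in $K$. It is $k$-sparse detectable with respect to $D\in\mathbb R^{v\times p}$ if $(A,LDC)$ is detectable for every matrix $L$ with $\ker L=D(\operatorname{span}V)$ for some set $V$ of at most $k$ standard basis vectors of $\mathbb R^p$. **Algorithm.** Let $\chi_u=\prod(X-\mu)$ over the eigenvalues $\mu$ of $A$ with $|\mu|\ge1$, with multiplicity; $N=\deg\chi_u$; $\hat A\in\mathbb R^{N\times N}$ the companion matrix of $\chi_u$ (ones on the superdiagonal, last row the negated coefficients of $\chi_u$); $U=\ker\chi_u(A)$ the unstable subspace. Put $Y_i[t]=(y_i[t],\dots,y_i[t+N-1])^T$, and let $\mathcal O$ be the stack of the matrices $\mathcal O_i$ with rows $C_iA^k$, $0\le k<N$. Sensor $i$ passes the local sanity check if the stacks of $n$ consecutive measurements of sensor $i$ satisfy exactly the recursion of the companion matrix of the characteristic polynomial of $A$ (attack-free sensors always do). With a compression matrix $D=(d_{ji})\in\mathbb R^{v\times p}$ and inputs $\phi_i^j[t]=d_{ji}Y_i[t]$, the tracking algorithm is, for $1\le j\le v$ and arbitrary initial values $W_i^j[0],b_i^j[0]\in\mathbb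 R^N$, $$\begin{aligned}W_i^j[t+1]&=(\hat A-I)W_i^j[t]-2k_I\sum_{l}a_{il}(\eta_l^j[t]-\eta_i^j[t])+\phi_i^j[t],\\ b_i^j[t+1]&=\hat A\,b_i^j[t]+k_I\sum_{l}a_{il}(W_l^j[t]-W_i^j[t]),\\ \eta_i^j[t]&=k_Pb_i^j[t]+k_I\sum_{l}a_{il}(W_l^j[t]-W_i^j[t]).\end{aligned}$$ The reconstruction step takes as $\hat x_i[t]$ the $x$-component of any minimizer of $\|p\,W_i[t]-(D\otimes I_N)(\mathcal O\tilde x+\tilde E)\|_2$ over $\tilde x\in U$ and $\tilde E\in\mathbb R^{pN}$ with at most $s$ non-zero blocks in $\mathbb R^N$. **Statement.** Suppose $(A,C)$ is $2s$-sparse detectable. Then $(A,C)$ is $2s$-sparse detectable with respect to $D=I_p$, and there are $k_I,k_P\in\mathbb R$ such that for every $D$ with respect to which $(A,C)$ is $2s$-sparse detectable: 1. The minimum in the reconstruction step is attained for every value of $W_i$. 2. For every trajectory $x$ and every attack on at most $s$ sensors such that all sensors pass the local sanity check, every run of the tracking algorithm, and every choice of minimizers, $\lim_{t\to\infty}\|\hat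 x_i[t]-x[t]\|=0$ for every node $i$. 3. Consequently the decentralized secure state-tracking problem is solved: consider the causal decentralized algorithm in which each node, in sampling period $t$, reads $y_i[t]$, performs the exact local sanity check on the measurements so far, runs one step of the tracking algorithm with the input $d_{ji}\,(y_i[t-N+1],\dots,y_i[t])^T$ (entries at negative times being $0$), replaced by $0$ from the moment the check has failed, by exchanging $W$ and then $\eta$ with its neighbours only, and takes as estimate of $x[t]$ the vector $A^{N-1}$ (identity if $N=0$) times the state reconstructed from $W_i$ as it stands at the beginning of period $t$. For all initial values of $W$ and $b$, every choice of minimizers, every trajectory $x$ and every attack (arbitrary signals) on at most $s$ sensors, the estimate of every node, attacked or not, satisfies $\lim_{t\to\infty}\|\hat x_i[t]-x[t]\|=0$. -/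

import Mathlib

open Filter Topology Polynomial

namespace DSST

/-! ### The communication network -/

/-- A time-invariant weighted undirected graph on the nodes `Fin p`: the weight of a pair is
positive on edges and zero otherwise. -/
structure Network (p : ℕ) where
  graph : SimpleGraph (Fin p)
  weight : Matrix (Fin p) (Fin p) ℝ
  weight_symm : ∀ i j, weight i j = weight j i
  weight_pos : ∀ i j, graph.Adj i j → 0 < weight i j
  weight_zero : ∀ i j, ¬ graph.Adj i j → weight i j = 0

/-- The set of neighbours of node `i`. -/
abbrev Network.Nbr {p : ℕ} (net : Network p) (i : Fin p) : Type :=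
  {l : Fin p // net.graph.Adj i l}

/-- The graph Laplacian: degree matrix minus weighted adjacency matrix. -/
def Network.laplacian {p : ℕ} (net : Network p) : Matrix (Fin p) (Fin p) ℝ :=
  Matrix.diagonal (fun i => ∑ j, net.weight i j) - net.weight

/-- The largest eigenvalue of the Laplacian (a positive semidefinite matrix). -/
noncomputable def Network.lambdaMax {p : ℕ} (net : Network p) : ℝ :=
  sSup (spectrum ℝ net.laplacian)

open Classical in
/-- `∑_{l ∈ N_i} a_{il} (u_l - u_i)`, computed from the values `u_l` received from the neighbours
of `i` and from the own value `u_i`. -/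
noncomputable def Network.disagreement {p : ℕ} (net : Network p) {V : Type} [AddCommGroup V]
    [Module ℝ V] (i : Fin p) (received : net.Nbr i → V) (own : V) : V :=
  ∑ l : net.Nbr i, net.weight i l.1 • (received l - own)

/-! ### Linear system, attacks, detectability -/

/-- Complex eigenvalues of a real square matrix. -/
def IsEigenvalue {n : ℕ} (A : Matrix (Fin n) (Fin n) ℝ) (μ : ℂ) : Prop :=
  μ ∈ spectrum ℂ (A.map (fun r : ℝ => (r : ℂ)))

/-- Compatibility of the sampled dynamics and the network: for every unstable eigenvalue
`μ = m + n i` of `A` and every non-zero eigenvalue `l` of the Laplacian,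
`(m - l² / l_max²)² + n² < 1`. -/
def SamplingCondition {p n : ℕ} (net : Network p) (A : Matrix (Fin n) (Fin n) ℝ) : Prop :=
  ∀ μ : ℂ, IsEigenvalue A μ → 1 ≤ ‖μ‖ →
    ∀ l : ℝ, l ∈ spectrum ℝ net.laplacian → l ≠ 0 →
      (μ.re - l ^ 2 / net.lambdaMax ^ 2) ^ 2 + μ.im ^ 2 < 1

/-- `(A, C)` is detectable: every unobservable eigenvalue of `A` (one with an eigenvector in the
kernel of `C`) is stable, i.e. has modulus less than one. -/
def Detectable {n : ℕ} {κ : Type*} (A : Matrix (Fin n) (Fin n) ℝ) (C : Matrix κ (Fin n) ℝ) :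
    Prop :=
  ∀ (μ : ℂ) (w : Fin n → ℂ), w ≠ 0 →
    (A.map (fun r : ℝ => (r : ℂ))).mulVec w = μ • w →
    (C.map (fun r : ℝ => (r : ℂ))).mulVec w = 0 → ‖μ‖ < 1

/-- `k`-sparse detectability: `(A, C_K)` is detectable for every set `K` of at least `p - k`
sensors. -/
def SparseDetectable {p n : ℕ} (A : Matrix (Fin n) (Fin n) ℝ) (C : Matrix (Fin p) (Fin n) ℝ)
    (k : ℕ) : Prop :=
  ∀ K : Finset (Fin p), p ≤ K.card + k →
    Detectable A (C.submatrix (fun i : K => (i : Fin p)) id)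

/-- `k`-sparse detectability with respect to a compression matrix `D`: `(A, L D C)` is detectable
for every matrix `L` whose kernel is the image under `D` of the span of at most `k` standard basis
vectors. -/
def SparseDetectableWrt {p n v : ℕ} (A : Matrix (Fin n) (Fin n) ℝ) (C : Matrix (Fin p) (Fin n) ℝ)
    (D : Matrix (Fin v) (Fin p) ℝ) (k : ℕ) : Prop :=
  ∀ V : Finset (Fin p), V.card ≤ k → ∀ (m : ℕ) (L : Matrix (Fin m) (Fin v) ℝ),
    LinearMap.ker L.mulVecLin =
      Submodule.map D.mulVecLin
        (Submodule.span ℝ ((fun i : Fin p => (Pi.single i (1 : ℝ) : Fin p → ℝ)) '' (V : Set (Fin p)))) →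
    Detectable A (L * D * C)

/-- `x` is a trajectory of `x[t+1] = A x[t]`. -/
def IsTrajectory {n : ℕ} (A : Matrix (Fin n) (Fin n) ℝ) (x : ℕ → Fin n → ℝ) : Prop :=
  ∀ t, x (t + 1) = A.mulVec (x t)

/-- The adversary attacks a fixed set of at most `s` sensors, with arbitrary signals. -/
def IsAttack {p : ℕ} (s : ℕ) (e : ℕ → Fin p → ℝ) : Prop :=
  ∃ S : Finset (Fin p), S.card ≤ s ∧ ∀ t, ∀ i ∉ S, e t i = 0

/-- The measurements `y_i[t] = C_i x[t] + e_i[t]`. -/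
def measurement {p n : ℕ} (C : Matrix (Fin p) (Fin n) ℝ) (x : ℕ → Fin n → ℝ)
    (e : ℕ → Fin p → ℝ) : ℕ → Fin p → ℝ :=
  fun t i => C.mulVec (x t) i + e t i

/-! ### Unstable part, companion form, sanity check -/

/-- The unstable factor of the characteristic polynomial of `A`: the product, with multiplicity,
of its monic irreducible real factors having a complex root of modulus at least one. As complex
conjugate roots have equal modulus, this is the product of the `X - μ` over the unstable
eigenvalues `μ` of `A`. -/
noncomputable def unstablePoly {n : ℕ} (A : Matrix (Fin n) (Fin n) ℝ) : ℝ[X] :=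
  letI := Classical.decPred (fun q : ℝ[X] => ∃ μ : ℂ, aeval μ q = 0 ∧ 1 ≤ ‖μ‖)
  ((UniqueFactorizationMonoid.normalizedFactors A.charpoly).filter
    (fun q : ℝ[X] => ∃ μ : ℂ, aeval μ q = 0 ∧ 1 ≤ ‖μ‖)).prod

/-- The number of unstable eigenvalues of `A`, with multiplicity; it is the dimension of the
unstable state portion. -/
noncomputable def unstableDim {n : ℕ} (A : Matrix (Fin n) (Fin n) ℝ) : ℕ :=
  (unstablePoly A).natDegree

/-- The unstable subspace of `A`: the sum of the generalized eigenspaces of the unstable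
eigenvalues. -/
noncomputable def unstableSubspace {n : ℕ} (A : Matrix (Fin n) (Fin n) ℝ) :
    Submodule ℝ (Fin n → ℝ) :=
  LinearMap.ker (aeval A (unstablePoly A)).mulVecLin

/-- The companion (controller form) matrix of a monic polynomial `q` of degree `N`: ones above the
diagonal, last row `-q_0, …, -q_{N-1}`. -/
def companion (N : ℕ) (q : ℝ[X]) : Matrix (Fin N) (Fin N) ℝ :=
  fun i j => if (i : ℕ) + 1 < N then (if (j : ℕ) = i + 1 then 1 else 0) else - q.coeff j

/-- The companion matrix driving the tracking algorithm. -/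
noncomputable def trackingMatrix {n : ℕ} (A : Matrix (Fin n) (Fin n) ℝ) :
    Matrix (Fin (unstableDim A)) (Fin (unstableDim A)) ℝ :=
  companion (unstableDim A) (unstablePoly A)

/-- The stacked measurements `Y_i[t] = (y_i[t], …, y_i[t+N-1])`. -/
def window {p : ℕ} (N : ℕ) (y : ℕ → Fin p → ℝ) (t : ℕ) (i : Fin p) : Fin N → ℝ :=
  fun k => y (t + k) i

/-- The measurements of sensor `i` pass the local sanity check: their stacks of length `n` follow
the companion form of `A`. -/
def PassesSanityCheck {p n : ℕ} (A : Matrix (Fin n) (Fin n) ℝ) (y : ℕ → Fin p → ℝ) (i : Fin p) :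
    Prop :=
  ∀ t, window n y (t + 1) i = (companion n A.charpoly).mulVec (window n y t i)

/-! ### The tracking algorithm -/

/-- `η_i = k_P b_i + k_I ∑_{l ∈ N_i} a_{il} (W_l - W_i)`, given that sum as `gap`. -/
def etaOf {V : Type} [AddCommGroup V] [Module ℝ V] (kI kP : ℝ) (b gap : V) : V :=
  kP • b + kI • gap

/-- `W_i[t+1]` from `W_i[t]`, the sum `∑_{l ∈ N_i} a_{il} (η_l - η_i)` (as `etaGap`) and the input
`φ_i[t]`; there is one block of length `N` for each row of the compression matrix. -/
def nextW {v N : ℕ} (F : Matrix (Fin N) (Fin N) ℝ) (kI : ℝ) (W etaGap φ : Fin v → Fin N → ℝ) :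
    Fin v → Fin N → ℝ :=
  fun j => (F - 1).mulVec (W j) - (2 * kI) • etaGap j + φ j

/-- `b_i[t+1]` from `b_i[t]` and the sum `∑_{l ∈ N_i} a_{il} (W_l - W_i)` (as `gap`). -/
def nextB {v N : ℕ} (F : Matrix (Fin N) (Fin N) ℝ) (kI : ℝ) (b gap : Fin v → Fin N → ℝ) :
    Fin v → Fin N → ℝ :=
  fun j => F.mulVec (b j) + kI • gap j

/-- `(W, b, η)` is a run of the tracking algorithm with inputs `φ`, from arbitrary initial
values `W[0]`, `b[0]`. -/
def IsTrackingRun {p v N : ℕ} (net : Network p) (F : Matrix (Fin N) (Fin N) ℝ) (kI kP : ℝ)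
    (φ W b η : ℕ → Fin p → Fin v → Fin N → ℝ) : Prop :=
  ∀ t i,
    W (t + 1) i = nextW F kI (W t i) (net.disagreement i (fun l => η t l.1) (η t i)) (φ t i) ∧
    b (t + 1) i = nextB F kI (b t i) (net.disagreement i (fun l => W t l.1) (W t i)) ∧
    η t i = etaOf kI kP (b t i) (net.disagreement i (fun l => W t l.1) (W t i))

/-! ### State reconstruction from compressed measurements -/

/-- The compressed stacked outputs `(D ⊗ I) (O x + E)`, where `O` stacks the matrices `O_i` with
rows `C_i A^k`, `k < N`. -/
def compressed {p n v N : ℕ} (A : Matrix (Fin n) (Fin n) ℝ) (C : Matrix (Fin p) (Fin n) ℝ)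
    (D : Matrix (Fin v) (Fin p) ℝ) (x : Fin n → ℝ) (E : Fin p → Fin N → ℝ) : Fin v → Fin N → ℝ :=
  fun j k => ∑ i, D j i * ((C * A ^ (k : ℕ)).mulVec x i + E i k)

/-- The Euclidean norm of a stacked vector. -/
noncomputable def stackNorm {v N : ℕ} (W : Fin v → Fin N → ℝ) : ℝ :=
  Real.sqrt (∑ j, ∑ k, W j k ^ 2)

/-- At most `s` blocks of `E` are non-zero. -/
def BlockSparse {p N : ℕ} (s : ℕ) (E : Fin p → Fin N → ℝ) : Prop :=
  {i | E i ≠ 0}.ncard ≤ s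

/-- `z` solves the reconstruction problem for the tracked value `W`: with some block-`s`-sparse
`E`, it minimizes `‖p W - (D ⊗ I)(O z + E)‖₂` over the unstable states `z` and the
block-`s`-sparse `E`. The factor `p` is there because `W` tracks `(1/p) (D ⊗ I) Y`. -/
def IsReconstruction {p n v : ℕ} (A : Matrix (Fin n) (Fin n) ℝ) (C : Matrix (Fin p) (Fin n) ℝ)
    (D : Matrix (Fin v) (Fin p) ℝ) (s : ℕ) (W : Fin v → Fin (unstableDim A) → ℝ)
    (z : Fin n → ℝ) : Prop :=
  z ∈ unstableSubspace A ∧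
    ∃ E : Fin p → Fin (unstableDim A) → ℝ, BlockSparse s E ∧
      ∀ z' ∈ unstableSubspace A, ∀ E' : Fin p → Fin (unstableDim A) → ℝ, BlockSparse s E' →
        stackNorm ((p : ℝ) • W - compressed A C D z E) ≤
          stackNorm ((p : ℝ) • W - compressed A C D z' E')

/-! ### Decentralized algorithms and the secure state-tracking problem -/

/-- A decentralized algorithm on a network, with estimates in `ℝⁿ`. In each sampling period node
`i` reads its own measurement (`sense`) and then takes part in a fixed number of synchronous
exchanges, in each of which it sends a message to its neighbours and updates its memory from
the messages received from them. -/
structure Algorithm {p : ℕ} (net : Network p) (n : ℕ) where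
  State : Fin p → Type
  Msg : Type
  rounds : ℕ
  init : ∀ i, State i
  sense : ∀ i, State i → ℝ → State i
  send : ∀ i, ℕ → State i → Msg
  receive : ∀ i, ℕ → State i → (net.Nbr i → Msg) → State i
  output : ∀ i, State i → Fin n → ℝ

/-- The memories after the first `k` exchanges of a sampling period. -/
def Algorithm.communicate {p n : ℕ} {net : Network p} (alg : Algorithm net n)
    (σ : ∀ i, alg.State i) : ℕ → ∀ i, alg.State i
  | 0 => σ
  | k + 1 => fun i =>
      alg.receive i k (alg.communicate σ k i) (fun l => alg.send l.1 k (alg.communicate σ k l.1))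

/-- The memories at the beginning of sampling period `t`, given the measurements `y`. -/
def Algorithm.run {p n : ℕ} {net : Network p} (alg : Algorithm net n) (y : ℕ → Fin p → ℝ) :
    ℕ → ∀ i, alg.State i
  | 0 => alg.init
  | t + 1 => alg.communicate (fun i => alg.sense i (alg.run y t i) (y t i)) alg.rounds

/-- The estimate of node `i` at time `t`; it depends on measurements up to time `t - 1` only. -/
def Algorithm.estimate {p n : ℕ} {net : Network p} (alg : Algorithm net n) (y : ℕ → Fin p → ℝ)
    (t : ℕ) (i : Fin p) : Fin n → ℝ :=
  alg.output i (alg.run y t i)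

/-- The algorithm solves the decentralized secure state-tracking problem: for every trajectory of
the system and every attack on at most `s` sensors, the estimate of every node, attacked or not,
tracks the state. -/
def Algorithm.Solves {p n : ℕ} {net : Network p} (alg : Algorithm net n)
    (A : Matrix (Fin n) (Fin n) ℝ) (C : Matrix (Fin p) (Fin n) ℝ) (s : ℕ) : Prop :=
  ∀ (x : ℕ → Fin n → ℝ) (e : ℕ → Fin p → ℝ), IsTrajectory A x → IsAttack s e →
    ∀ i, Tendsto (fun t => ‖alg.estimate (measurement C x e) t i - x t‖) atTop (𝓝 0)

/-! ### The tracking algorithm as a decentralized algorithm -/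

/-- The memory of a node: the current time, the last `n` and the last `N` own measurements,
whether the local sanity check was always passed so far, and the variables `W_i`, `b_i`, `η_i`
together with the auxiliary sum `gap = ∑_{l ∈ N_i} a_{il} (W_l - W_i)`. -/
structure Memory (n N v : ℕ) where
  time : ℕ
  past : Fin n → ℝ
  recent : Fin N → ℝ
  clean : Prop
  W : Fin v → Fin N → ℝ
  b : Fin v → Fin N → ℝ
  gap : Fin v → Fin N → ℝ
  η : Fin v → Fin N → ℝ

/-- Drop the oldest entry and append `y`. -/
def shiftIn {m : ℕ} (u : Fin m → ℝ) (y : ℝ) : Fin m → ℝ :=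
  fun k => if h : (k : ℕ) + 1 < m then u ⟨k + 1, h⟩ else y

/-- Read a measurement, and perform the local sanity check once `n` earlier measurements are
available. -/
def Memory.sense {n N v : ℕ} (A : Matrix (Fin n) (Fin n) ℝ) (m : Memory n N v) (y : ℝ) :
    Memory n N v :=
  { m with
    time := m.time + 1
    past := shiftIn m.past y
    recent := shiftIn m.recent y
    clean := m.clean ∧
      (n ≤ m.time → shiftIn m.past y = (companion n A.charpoly).mulVec m.past) }

open Classical in
/-- The input `φ_i^j = d_{ji} Y_i` of a node with column `d` of the compression matrix; a node that
has failed the local sanity check knows that its sensor is attacked and uses zero instead. -/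
noncomputable def Memory.input {n N v : ℕ} (d : Fin v → ℝ) (m : Memory n N v) :
    Fin v → Fin N → ℝ :=
  fun j => if m.clean then d j • m.recent else 0

/-- The decentralized algorithm that runs the tracking algorithm on the latest measurements, with
initial values `W0`, `b0`, and applies the reconstruction `recon` to the tracked value. Each
sampling period has two exchanges: of the `W_i`, to compute `η_i`, and then of the `η_i`. Since the
latest stack of length `N` starts `N - 1` steps in the past, the reconstructed state is moved
forward by `A ^ (N - 1)`. -/
noncomputable def trackingAlgorithm {p n v : ℕ} (net : Network p) (A : Matrix (Fin n) (Fin n) ℝ)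
    (D : Matrix (Fin v) (Fin p) ℝ) (kI kP : ℝ)
    (W0 b0 : Fin p → Fin v → Fin (unstableDim A) → ℝ)
    (recon : Fin p → (Fin v → Fin (unstableDim A) → ℝ) → Fin n → ℝ) : Algorithm net n where
  State := fun _ => Memory n (unstableDim A) v
  Msg := Fin v → Fin (unstableDim A) → ℝ
  rounds := 2
  init := fun i =>
    { time := 0, past := 0, recent := 0, clean := True, W := W0 i, b := b0 i, gap := 0, η := 0 }
  sense := fun _ m y => m.sense A y
  send := fun _ k m => if k = 0 then m.W else m.η
  receive := fun i k m msg =>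
    if k = 0 then
      { m with
        gap := net.disagreement i msg m.W
        η := etaOf kI kP m.b (net.disagreement i msg m.W) }
    else
      { m with
        W := nextW (trackingMatrix A) kI m.W (net.disagreement i msg m.η)
          (m.input (fun j => D j i))
        b := nextB (trackingMatrix A) kI m.b m.gap }
  output := fun i m => (A ^ (unstableDim A - 1)).mulVec (recon i m.W)

end DSST

namespace DSST

/-! ### The shift operator on sequences -/

/-! Sequences are studied modulo null sequences, on which polynomials in the shift act. If `q(shift)
y` tends to zero and all complex roots of `q` lie in the open unit disc, then `y` tends to zero
(`mem_nullSeq_of_aeval`). Hence a recursion with matrix F - a, where F is the companion matrix of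
`q` and a is a scalar, is stable under vanishing errors as soon as every root of `q`, minus a, lies
in the disc (`tendsto_zero_of_companion_sub`).

Tracking (`tendsto_tracking`): let R be the Laplacian, k = k_I and k_P = 1. The combination c = W -
2kRb obeys c[t+1] = (F - 1)c[t] + φ[t], without any network coupling, so c - φ vanishes
asymptotically whenever φ[t+1] - Fφ[t] does. Then RW splits into eigenmodes l of R with matrices F -
2k²l², driven by the vanishing term -R(c - φ), so RW tends to zero and the nodes agree. The column
sums of R are zero, so c and W have the same sum over the nodes, and pW tracks the sum of the
inputs. The gain k = 1/(√2 λ_max) turns 2k²l² into l²/λ_max²; for p ≥ 2 the eigenvalue l = λ_max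
also gives stability of F - 1.

Reconstruction (`tendsto_reconstruction`): a sensor passing the check obeys the characteristic
recursion even if attacked, so its stacks follow F up to a null error, which is all that tracking
needs. A sensor failing it is attacked, and its replacement input 0 follows F trivially. Comparing a
minimizer with the unstable part of the true state leaves a 2s-sparse difference whose compressed
output vanishes. For each of the finitely many supports, detectability with respect to `D` makes the
state a linear function of that output (`exists_leftInverse_compressed`), so the state error
vanishes too. The stable part of the trajectory is itself a null sequence. -/

/-- The left shift on sequences. -/
def shift (K V : Type*) [CommRing K] [AddCommGroup V] [Module K V] : Module.End K (ℕ → V) where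
  toFun y t := y (t + 1)
  map_add' _ _ := rfl
  map_smul' _ _ := rfl

section Shift

variable {K V : Type*} [CommRing K] [AddCommGroup V] [Module K V]

@[simp] theorem shift_apply (y : ℕ → V) (t : ℕ) : shift K V y t = y (t + 1) := rfl

theorem shift_pow_apply (k : ℕ) (y : ℕ → V) (t : ℕ) : (shift K V ^ k) y t = y (t + k) := by
  induction k generalizing t with
  | zero => simp
  | succ k ih => rw [pow_succ', Module.End.mul_apply, shift_apply, ih]; congr 1; omega

theorem aeval_shift_apply (q : K[X]) (y : ℕ → V) (t : ℕ) :
    aeval (shift K V) q y t = ∑ k ∈ Finset.range (q.natDegree + 1), q.coeff k • y (t + k) := by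
  rw [aeval_eq_sum_range]
  simp [LinearMap.sum_apply, Finset.sum_apply, shift_pow_apply]

theorem aeval_shift_comp {V' : Type*} [AddCommGroup V'] [Module K V'] (f : V →ₗ[K] V') (q : K[X])
    (y : ℕ → V) :
    aeval (shift K V') q (fun t => f (y t)) = fun t => f (aeval (shift K V) q y t) := by
  funext t
  simp [aeval_shift_apply]

end Shift

/-- The sequences that tend to zero. -/
def nullSeq (K V : Type*) [NormedField K] [NormedAddCommGroup V] [NormedSpace K V] :
    Submodule K (ℕ → V) where
  carrier := {y | Tendsto y atTop (𝓝 0)}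
  add_mem' {a b} ha hb := by
    have := Tendsto.add ha hb
    rwa [add_zero] at this
  zero_mem' := tendsto_const_nhds
  smul_mem' c y hy := by
    have := Tendsto.const_smul hy c
    rwa [smul_zero] at this

section Null

variable {K V : Type*} [NormedField K] [NormedAddCommGroup V] [NormedSpace K V]

theorem mem_nullSeq {y : ℕ → V} : y ∈ nullSeq K V ↔ Tendsto y atTop (𝓝 0) := Iff.rfl

/-- This lets congruences modulo null sequences be multiplied by polynomials in the shift. -/
theorem aeval_shift_mem_nullSeq {y : ℕ → V} (hy : y ∈ nullSeq K V) (q : K[X]) :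
    aeval (shift K V) q y ∈ nullSeq K V := by
  have h : nullSeq K V ∈ (shift K V).invtSubmodule := fun y hy => (tendsto_add_atTop_iff_nat 1).2 hy
  induction q using Polynomial.induction_on' with
  | add p q hp hq => simpa using add_mem hp hq
  | monomial k a =>
    rw [aeval_monomial]
    refine Submodule.smul_mem _ a ?_
    have : Tendsto (fun t => y (t + k)) atTop (𝓝 0) := (tendsto_add_atTop_iff_nat k).2 hy
    have e : (shift K V ^ k) y = fun t => y (t + k) := funext (shift_pow_apply k y)
    exact e ▸ this

end Null

/-! ### Stable recursions driven by vanishing inputs -/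

theorem tendsto_zero_of_le_mul_add {a e : ℕ → ℝ} {r : ℝ} (ha : ∀ t, 0 ≤ a t) (hr0 : 0 ≤ r)
    (hr : r < 1) (he : Tendsto e atTop (𝓝 0)) (h : ∀ t, a (t + 1) ≤ r * a t + e t) :
    Tendsto a atTop (𝓝 0) := by
  rw [Metric.tendsto_atTop]
  intro ε hε
  -- With errors below this threshold, ε/2 bounds the fixed point of the recursion, so the excess of
  -- `a` over ε/2 contracts by `r` at each step.
  have h1 : 0 < (1 - r) * (ε / 2) := by
    have : 0 < 1 - r := by linarith
    positivity
  obtain ⟨T, hT⟩ := eventually_atTop.1 (he.eventually_lt_const h1)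
  have hk : ∀ k, a (T + k) - ε / 2 ≤ r ^ k * |a T - ε / 2| := by
    intro k
    induction k with
    | zero => simpa using le_abs_self (a T - ε / 2)
    | succ k ih =>
      have h2 := h (T + k)
      have h3 := hT (T + k) (by omega)
      have h4 := mul_le_mul_of_nonneg_left ih hr0
      rw [pow_succ', mul_assoc, ← add_assoc]
      linarith
  have h5 : Tendsto (fun k => r ^ k * |a T - ε / 2|) atTop (𝓝 0) := by
    simpa using (tendsto_pow_atTop_nhds_zero_of_lt_one hr0 hr).mul_const |a T - ε / 2|
  obtain ⟨M, hM⟩ := eventually_atTop.1 (h5.eventually_lt_const (half_pos hε))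
  refine ⟨T + M, fun t ht => ?_⟩
  have h6 := hk (t - T)
  have h7 := hM (t - T) (by omega)
  rw [show T + (t - T) = t by omega] at h6
  rw [Real.dist_eq, sub_zero, abs_of_nonneg (ha t)]
  linarith

theorem mem_nullSeq_of_shift_sub_smul {y : ℕ → ℂ} {μ : ℂ} (hμ : ‖μ‖ < 1)
    (h : shift ℂ ℂ y - μ • y ∈ nullSeq ℂ ℂ) : y ∈ nullSeq ℂ ℂ := by
  rw [mem_nullSeq, tendsto_zero_iff_norm_tendsto_zero] at *
  refine tendsto_zero_of_le_mul_add (fun t => norm_nonneg _) (norm_nonneg μ) hμ h fun t => ?_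
  have : y (t + 1) = μ * y t + (shift ℂ ℂ y - μ • y) t := by simp
  rw [this, ← norm_mul]
  exact norm_add_le _ _

/-- Over ℂ the polynomial splits, and the linear factors are peeled off one at a time, each being a
first-order stable recursion. -/
theorem mem_nullSeq_of_aeval_complex (q : ℂ[X]) (hq : q ≠ 0) (hroot : ∀ z ∈ q.roots, ‖z‖ < 1)
    {y : ℕ → ℂ} (h : aeval (shift ℂ ℂ) q y ∈ nullSeq ℂ ℂ) : y ∈ nullSeq ℂ ℂ := by
  have key : ∀ s : Multiset ℂ, (∀ z ∈ s, ‖z‖ < 1) → ∀ y : ℕ → ℂ,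
      aeval (shift ℂ ℂ) (s.map fun z => X - C z).prod y ∈ nullSeq ℂ ℂ → y ∈ nullSeq ℂ ℂ := by
    intro s
    induction s using Multiset.induction_on with
    | empty => intro _ y h; simpa using h
    | cons z s ih =>
      intro hs y h
      rw [Multiset.map_cons, Multiset.prod_cons, map_mul, Module.End.mul_apply] at h
      refine ih (fun w hw => hs w (Multiset.mem_cons_of_mem hw)) y
        (mem_nullSeq_of_shift_sub_smul (hs z (Multiset.mem_cons_self z s)) ?_)
      simpa [Module.algebraMap_end_apply] using h
  refine key q.roots hroot y ?_
  rw [← C_leadingCoeff_mul_prod_multiset_X_sub_C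
    (splits_iff_card_roots.1 (IsAlgClosed.splits q)), map_mul, aeval_C, Module.End.mul_apply,
    Module.algebraMap_end_apply] at h
  exact (Submodule.smul_mem_iff _ (leadingCoeff_ne_zero.2 hq)).1 h

theorem mem_nullSeq_of_aeval (q : ℝ[X]) (hq : q ≠ 0)
    (hroot : ∀ z : ℂ, aeval z q = 0 → ‖z‖ < 1) {y : ℕ → ℝ}
    (h : aeval (shift ℝ ℝ) q y ∈ nullSeq ℝ ℝ) : y ∈ nullSeq ℝ ℝ := by
  have h1 : aeval (shift ℂ ℂ) (q.map (algebraMap ℝ ℂ)) (fun t => (y t : ℂ)) =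
      fun t => ((aeval (shift ℝ ℝ) q y t : ℝ) : ℂ) := by
    funext t
    rw [aeval_shift_apply, aeval_shift_apply, natDegree_map]
    simp
  have h2 : (fun t => (y t : ℂ)) ∈ nullSeq ℂ ℂ := by
    refine mem_nullSeq_of_aeval_complex (q.map (algebraMap ℝ ℂ)) (map_ne_zero hq)
      (fun z hz => hroot z ?_) ?_
    · rw [mem_roots (map_ne_zero hq), IsRoot, eval_map_algebraMap] at hz
      exact hz
    · rw [h1, mem_nullSeq]
      exact_mod_cast (Complex.continuous_ofReal.tendsto 0).comp (mem_nullSeq.1 h)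
  rw [mem_nullSeq, tendsto_zero_iff_norm_tendsto_zero] at *
  simpa using h2

/-! ### The unstable factor of the characteristic polynomial -/

/-- An irreducible real polynomial is associated to the minimal polynomial of each of its roots, so
a real polynomial vanishing at one root vanishes at all. Testing with a linear or quadratic
polynomial shows that two roots are equal or conjugate. Hence sorting the factors by the modulus of
some root sorts all roots. -/
theorem Irreducible.norm_eq_of_aeval_eq_zero {q : ℝ[X]} (hq : Irreducible q) {μ ν : ℂ}
    (hμ : aeval μ q = 0) (hν : aeval ν q = 0) : ‖μ‖ = ‖ν‖ := by
  have hdvd : ∀ (z : ℂ) (f : ℝ[X]), aeval z q = 0 → aeval z f = 0 → q ∣ f := fun z f hz hf =>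
    ((minpoly.irreducible (IsAlgebraic.isIntegral ⟨q, hq.ne_zero, hz⟩)).dvd_symm hq
      (minpoly.dvd ℝ z hz)).trans (minpoly.dvd ℝ z hf)
  by_cases him : ν.im = 0
  · have h1 : aeval ν (X - C ν.re : ℝ[X]) = 0 := by
      apply Complex.ext <;> simp [him]
    have h2 := aeval_eq_zero_of_dvd_aeval_eq_zero (hdvd ν _ hν h1) hμ
    rw [map_sub, aeval_X, aeval_C, sub_eq_zero] at h2
    have h3 : ν = algebraMap ℝ ℂ ν.re := by apply Complex.ext <;> simp [him]
    rw [h2, ← h3]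
  · have h1 : aeval μ (X * X - C (2 * μ.re) * X + C (Complex.normSq μ) : ℝ[X]) = 0 := by
      apply Complex.ext <;> simp [Complex.normSq_apply] <;> ring
    have h2 := aeval_eq_zero_of_dvd_aeval_eq_zero (hdvd μ _ hμ h1) hν
    have hre := congrArg Complex.re h2
    have hi := congrArg Complex.im h2
    simp at hre hi
    have h3 : μ.re = ν.re := by
      have : (2 * (ν.re - μ.re)) * ν.im = 0 := by linarith
      rcases mul_eq_zero.1 this with h | h
      · linarith
      · exact absurd h him
    have h4 : Complex.normSq μ = Complex.normSq ν := by
      rw [Complex.normSq_apply ν]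
      rw [h3] at hre
      linarith
    rw [Complex.normSq_eq_norm_sq, Complex.normSq_eq_norm_sq] at h4
    exact (sq_eq_sq₀ (norm_nonneg _) (norm_nonneg _)).1 h4

/-- The product of the irreducible real factors of the characteristic polynomial whose complex
roots have modulus less than one. -/
noncomputable def stablePoly {n : ℕ} (A : Matrix (Fin n) (Fin n) ℝ) : ℝ[X] :=
  letI := Classical.decPred (fun q : ℝ[X] => ∃ μ : ℂ, aeval μ q = 0 ∧ 1 ≤ ‖μ‖)
  ((UniqueFactorizationMonoid.normalizedFactors A.charpoly).filter
    (fun q : ℝ[X] => ¬ ∃ μ : ℂ, aeval μ q = 0 ∧ 1 ≤ ‖μ‖)).prod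

section Unstable

variable {n : ℕ} (A : Matrix (Fin n) (Fin n) ℝ)

theorem unstablePoly_mul_stablePoly : unstablePoly A * stablePoly A = A.charpoly := by
  classical
  unfold unstablePoly stablePoly
  rw [← Multiset.prod_add, Multiset.filter_add_not,
    UniqueFactorizationMonoid.prod_normalizedFactors_eq A.charpoly_monic.ne_zero,
    A.charpoly_monic.normalize_eq_self]

theorem unstablePoly_monic : (unstablePoly A).Monic := by
  classical
  unfold unstablePoly
  refine monic_multiset_prod_of_monic _ id ?_ |> fun h => by simpa using h
  intro q hq
  have hq' := Multiset.mem_of_mem_filter hq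
  rw [id, ← UniqueFactorizationMonoid.normalize_normalized_factor q hq']
  exact monic_normalize (UniqueFactorizationMonoid.irreducible_of_normalized_factor q hq').ne_zero

theorem stablePoly_ne_zero : stablePoly A ≠ 0 := by
  intro h
  exact A.charpoly_monic.ne_zero (by rw [← unstablePoly_mul_stablePoly, h, mul_zero])

variable {A}

theorem one_le_norm_of_aeval_unstablePoly {μ : ℂ} (h : aeval μ (unstablePoly A) = 0) :
    1 ≤ ‖μ‖ := by
  classical
  unfold unstablePoly at h
  rw [map_multiset_prod, Multiset.prod_eq_zero_iff, Multiset.mem_map] at h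
  obtain ⟨q, hq, hμ⟩ := h
  rw [Multiset.mem_filter] at hq
  obtain ⟨hq, ν, hν, h1⟩ := hq
  rwa [Irreducible.norm_eq_of_aeval_eq_zero
    (UniqueFactorizationMonoid.irreducible_of_normalized_factor q hq) hμ hν]

theorem norm_lt_one_of_aeval_stablePoly {μ : ℂ} (h : aeval μ (stablePoly A) = 0) :
    ‖μ‖ < 1 := by
  classical
  unfold stablePoly at h
  rw [map_multiset_prod, Multiset.prod_eq_zero_iff, Multiset.mem_map] at h
  obtain ⟨q, hq, hμ⟩ := h
  rw [Multiset.mem_filter] at hq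
  by_contra hn
  exact hq.2 ⟨μ, hμ, not_lt.1 hn⟩

theorem isEigenvalue_of_aeval_unstablePoly {μ : ℂ} (h : aeval μ (unstablePoly A) = 0) :
    IsEigenvalue A μ := by
  have e : A.map (fun r : ℝ => (r : ℂ)) = A.map (algebraMap ℝ ℂ) := rfl
  rw [IsEigenvalue, Matrix.mem_spectrum_iff_isRoot_charpoly, e, Matrix.charpoly_map, IsRoot,
    eval_map_algebraMap, ← unstablePoly_mul_stablePoly, map_mul, h, zero_mul]

variable (A)

/-- The moduli of the roots separate the two factors, so they share no complex root. -/
theorem isCoprime_unstablePoly_stablePoly : IsCoprime (unstablePoly A) (stablePoly A) := by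
  rw [isCoprime_iff_aeval_ne_zero_of_isAlgClosed ℝ ℂ]
  intro μ
  by_contra! h
  exact (one_le_norm_of_aeval_unstablePoly h.1).not_gt (norm_lt_one_of_aeval_stablePoly h.2)

end Unstable

/-! ### Stability of shifted companion dynamics -/

/-- If `x[t+1] = (F - c) x[t]` up to a vanishing error, where `F` is the companion matrix of `q`,
and `r - c` lies in the open unit disc for every root `r` of `q`, then `x` vanishes. -/
theorem tendsto_zero_of_companion_sub {N : ℕ} {q : ℝ[X]} (hq : q.Monic) (hN : q.natDegree = N)
    (c : ℝ) (hroot : ∀ z : ℂ, aeval z q = 0 → ‖z - c‖ < 1) {x : ℕ → Fin N → ℝ}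
    (h : Tendsto (fun t => x (t + 1) - ((companion N q).mulVec (x t) - c • x t)) atTop (𝓝 0)) :
    Tendsto x atTop (𝓝 0) := by
  rcases Nat.eq_zero_or_pos N with h0 | h0
  · subst h0
    have : x = fun _ => 0 := Subsingleton.elim _ _
    rw [this]; exact tendsto_const_nhds
  -- Adding `c` to the shift undoes the subtraction in F - c: modulo null sequences `T` acts on the
  -- coordinates as F, sending each to the next and the last to minus the combination with the
  -- coefficients of `q`.
  set T : Module.End ℝ (ℕ → ℝ) := aeval (shift ℝ ℝ) (X + C c) with hT
  have hTx : ∀ (y : ℕ → ℝ) t, T y t = y (t + 1) + c * y t := fun y t => by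
    simp [hT, Module.algebraMap_end_apply]
  set u : ℕ → ℕ → ℝ := fun k t => if hk : k < N then x t ⟨k, hk⟩ else 0 with hu
  rw [tendsto_pi_nhds] at h
  have hTu : ∀ k, k + 1 < N → T (u k) - u (k + 1) ∈ nullSeq ℝ ℝ := by
    intro k hk
    have := h ⟨k, by omega⟩
    rw [mem_nullSeq]
    refine this.congr fun t => ?_
    have e : (companion N q).mulVec (x t) ⟨k, by omega⟩ = x t ⟨k + 1, hk⟩ := by
      rw [Matrix.mulVec, dotProduct, Finset.sum_eq_single ⟨k + 1, hk⟩]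
      · simp [companion, hk]
      · intro j _ hj
        have : (j : ℕ) ≠ k + 1 := fun h => hj (Fin.ext h)
        simp [companion, hk, this]
      · simp
    simp [hTx, hu, hk, show k < N by omega, e]
    ring
  have hpow : ∀ k, k < N → u k - (T ^ k) (u 0) ∈ nullSeq ℝ ℝ := by
    intro k
    induction k with
    | zero => intro _; simp
    | succ k ih =>
      intro hk
      have h1 := aeval_shift_mem_nullSeq (ih (by omega)) (X + C c)
      rw [← hT, map_sub] at h1
      have h2 := sub_mem h1 (hTu k hk)
      rw [pow_succ', Module.End.mul_apply]
      convert h2 using 1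
      abel
  have hlast : T (u (N - 1)) + ∑ j ∈ Finset.range N, q.coeff j • u j ∈ nullSeq ℝ ℝ := by
    have := h ⟨N - 1, by omega⟩
    rw [mem_nullSeq]
    refine this.congr fun t => ?_
    have e : (companion N q).mulVec (x t) ⟨N - 1, by omega⟩ =
        - ∑ j ∈ Finset.range N, q.coeff j * u j t := by
      rw [Matrix.mulVec, dotProduct, Finset.sum_range, ← Finset.sum_neg_distrib]
      refine Finset.sum_congr rfl fun j _ => ?_
      simp [companion, hu, show ¬ (N - 1 + 1 < N) by omega]
    have e2 : (∑ j ∈ Finset.range N, q.coeff j • u j) t =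
        ∑ j ∈ Finset.range N, q.coeff j * u j t := by simp [Finset.sum_apply]
    rw [Pi.add_apply, hTx, e2]
    simp only [Pi.sub_apply, Pi.smul_apply, e, smul_eq_mul]
    simp [hu, h0]
    ring
  -- Replacing each coordinate by a power of `T` applied to the first turns the last row of the
  -- companion matrix into `q(T)`.
  have hq0 : aeval T q (u 0) ∈ nullSeq ℝ ℝ := by
    have h1 : aeval T q (u 0) = (T ^ N) (u 0) + ∑ j ∈ Finset.range N, q.coeff j • (T ^ j) (u 0) := by
      rw [aeval_eq_sum_range, Finset.sum_range_succ, hN]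
      have : q.coeff N = 1 := hN ▸ hq.coeff_natDegree
      simp [this, LinearMap.sum_apply, add_comm]
    have h2 : ∑ j ∈ Finset.range N, q.coeff j • (u j - (T ^ j) (u 0)) ∈ nullSeq ℝ ℝ :=
      Submodule.sum_mem _ fun j hj => Submodule.smul_mem _ _ (hpow j (Finset.mem_range.1 hj))
    have h3 := aeval_shift_mem_nullSeq (hpow (N - 1) (by omega)) (X + C c)
    rw [← hT, map_sub, ← Module.End.mul_apply, ← pow_succ', show N - 1 + 1 = N by omega] at h3
    have h4 := sub_mem (sub_mem hlast h3) h2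
    rw [h1]
    convert h4 using 1
    simp only [smul_sub, Finset.sum_sub_distrib]
    abel
  have hu0 : u 0 ∈ nullSeq ℝ ℝ := by
    -- As a polynomial in the shift, `q(T)` is `q` composed with X + c, whose roots are those of `q`
    -- minus `c`.
    refine mem_nullSeq_of_aeval (q.comp (X + C c)) ?_ ?_ (by rwa [aeval_comp, ← hT])
    · exact (hq.comp_X_add_C c).ne_zero
    · intro z hz
      rw [aeval_comp] at hz
      simpa using hroot _ hz
  rw [tendsto_pi_nhds]
  intro k
  have h1 : (T ^ (k : ℕ)) (u 0) ∈ nullSeq ℝ ℝ := by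
    rw [hT, ← map_pow]
    exact aeval_shift_mem_nullSeq hu0 _
  have h2 := add_mem (hpow k k.2) h1
  rw [sub_add_cancel, mem_nullSeq] at h2
  simpa [hu] using h2

/-! ### Linear algebra -/

/-- The map is determined on the range of `f` by passing to the quotient, and extends linearly to
the whole space. -/
theorem exists_comp_eq_of_ker_le {K V W X : Type*} [Field K] [AddCommGroup V] [Module K V]
    [AddCommGroup W] [Module K W] [AddCommGroup X] [Module K X] (f : V →ₗ[K] W) (g : V →ₗ[K] X)
    (h : LinearMap.ker f ≤ LinearMap.ker g) : ∃ k : W →ₗ[K] X, ∀ v, k (f v) = g v := by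
  obtain ⟨k, hk⟩ := LinearMap.exists_extend
    (((LinearMap.ker f).liftQ g h).comp f.quotKerEquivRange.symm.toLinearMap)
  refine ⟨k, fun v => ?_⟩
  have h1 := LinearMap.congr_fun hk ⟨f v, LinearMap.mem_range_self f v⟩
  have h2 : f.quotKerEquivRange.symm ⟨f v, LinearMap.mem_range_self f v⟩ =
      (LinearMap.ker f).mkQ v := by
    rw [LinearEquiv.symm_apply_eq]; rfl
  simpa [h2] using h1

/-! ### The Laplacian -/

namespace Network

variable {p : ℕ} (net : Network p)

theorem weight_self (i : Fin p) : net.weight i i = 0 := net.weight_zero i i (net.graph.loopless.irrefl i)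

theorem weight_nonneg (i j : Fin p) : 0 ≤ net.weight i j := by
  by_cases h : net.graph.Adj i j
  · exact (net.weight_pos i j h).le
  · exact (net.weight_zero i j h).ge

theorem laplacian_mulVec_apply (u : Fin p → ℝ) (i : Fin p) :
    net.laplacian.mulVec u i = ∑ j, net.weight i j * (u i - u j) := by
  rw [laplacian, Matrix.sub_mulVec, Pi.sub_apply, Matrix.mulVec_diagonal]
  simp only [Matrix.mulVec, dotProduct, mul_sub, Finset.sum_sub_distrib, Finset.sum_mul]

theorem disagreement_eq {V : Type} [AddCommGroup V] [Module ℝ V] (i : Fin p) (u : Fin p → V) :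
    net.disagreement i (fun l => u l.1) (u i) = ∑ j, net.weight i j • (u j - u i) := by
  classical
  unfold disagreement
  rw [← Finset.sum_subset (Finset.subset_univ (Finset.univ.filter fun l => net.graph.Adj i l))]
  · rw [Finset.sum_subtype (p := fun l => net.graph.Adj i l) _ (by simp)]
  · intro j _ hj
    rw [net.weight_zero i j (by simpa using hj), zero_smul]

theorem laplacian_isHermitian : net.laplacian.IsHermitian := by
  refine Matrix.IsHermitian.sub (Matrix.isHermitian_diagonal _) ?_
  ext i j
  simp [net.weight_symm i j]

theorem one_vecMul_laplacian : Matrix.vecMul (fun _ => (1 : ℝ)) net.laplacian = 0 := by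
  have h : net.laplacian.transpose = net.laplacian := net.laplacian_isHermitian
  rw [← Matrix.mulVec_transpose, h]
  ext i
  simp [laplacian_mulVec_apply]

/-- Averaging over the two orders of each pair, using symmetric weights, exhibits the quadratic form
as a sum of squares. -/
theorem dotProduct_laplacian_mulVec (u : Fin p → ℝ) :
    2 * (u ⬝ᵥ net.laplacian.mulVec u) = ∑ i, ∑ j, net.weight i j * (u i - u j) ^ 2 := by
  have h1 : u ⬝ᵥ net.laplacian.mulVec u = ∑ i, ∑ j, net.weight i j * (u i * (u i - u j)) := by
    simp only [dotProduct, laplacian_mulVec_apply, Finset.mul_sum]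
    exact Finset.sum_congr rfl fun i _ => Finset.sum_congr rfl fun j _ => by ring
  have h2 : u ⬝ᵥ net.laplacian.mulVec u = ∑ i, ∑ j, net.weight i j * (u j * (u j - u i)) := by
    rw [h1, Finset.sum_comm]
    exact Finset.sum_congr rfl fun i _ => Finset.sum_congr rfl fun j _ => by
      rw [net.weight_symm]
  rw [two_mul]
  nth_rewrite 1 [h1]
  rw [h2]
  simp only [← Finset.sum_add_distrib]
  exact Finset.sum_congr rfl fun i _ => Finset.sum_congr rfl fun j _ => by ring

variable {net}

/-- The quadratic form vanishes, hence so does each term: `u` is constant across edges, and then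
along walks. -/
theorem eq_of_laplacian_mulVec_eq_zero (hconn : net.graph.Connected) {u : Fin p → ℝ}
    (hu : net.laplacian.mulVec u = 0) (i j : Fin p) : u i = u j := by
  have h := net.dotProduct_laplacian_mulVec u
  rw [hu, dotProduct_zero, mul_zero, eq_comm, Finset.sum_eq_zero_iff_of_nonneg fun i _ =>
    Finset.sum_nonneg fun j _ => mul_nonneg (net.weight_nonneg i j) (sq_nonneg _)] at h
  have hadj : ∀ a b, net.graph.Adj a b → u a = u b := by
    intro a b hab
    have h1 := h a (Finset.mem_univ a)
    rw [Finset.sum_eq_zero_iff_of_nonneg fun j _ =>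
      mul_nonneg (net.weight_nonneg a j) (sq_nonneg _)] at h1
    have h2 := h1 b (Finset.mem_univ b)
    have h3 := (net.weight_pos a b hab).ne'
    have h4 : (u a - u b) ^ 2 = 0 := (mul_eq_zero.1 h2).resolve_left h3
    exact sub_eq_zero.1 (pow_eq_zero_iff two_ne_zero |>.1 h4)
  obtain ⟨w⟩ := hconn.preconnected i j
  induction w with
  | nil => rfl
  | cons hab _ ih => exact (hadj _ _ hab).trans ih

/-- On a connected network the deviation from the mean is a linear function of the Laplacian. -/
theorem exists_mul_laplacian (hconn : net.graph.Connected) :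
    ∃ G : Matrix (Fin p) (Fin p) ℝ,
      G * net.laplacian = (p : ℝ) • (1 : Matrix (Fin p) (Fin p) ℝ) - Matrix.of fun _ _ => 1 := by
  -- The kernel of the Laplacian consists of constant vectors, which p·1 minus the all-ones matrix
  -- kills.
  obtain ⟨k, hk⟩ := exists_comp_eq_of_ker_le net.laplacian.mulVecLin
    ((p : ℝ) • (1 : Matrix (Fin p) (Fin p) ℝ) - Matrix.of fun _ _ => 1).mulVecLin (by
      intro u hu
      have h1 := eq_of_laplacian_mulVec_eq_zero hconn (u := u) hu
      rw [LinearMap.mem_ker]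
      ext i
      rw [Matrix.mulVecLin_apply, Matrix.sub_mulVec, Matrix.smul_mulVec, Matrix.one_mulVec]
      simp only [Pi.sub_apply, Pi.smul_apply, Matrix.mulVec, dotProduct, Matrix.of_apply, one_mul]
      rw [Finset.sum_congr rfl fun j _ => h1 j i]
      simp)
  refine ⟨LinearMap.toMatrix' k, ?_⟩
  apply Matrix.mulVec_injective
  funext u
  rw [← Matrix.mulVec_mulVec, LinearMap.toMatrix'_mulVec]
  exact hk u

theorem spectrum_laplacian_finite : (spectrum ℝ net.laplacian).Finite :=
  Matrix.finite_real_spectrum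

theorem lambdaMax_mem_spectrum (hp : 0 < p) : net.lambdaMax ∈ spectrum ℝ net.laplacian := by
  refine Set.Nonempty.csSup_mem ?_ spectrum_laplacian_finite
  exact ⟨_, net.laplacian_isHermitian.eigenvalues_mem_spectrum_real ⟨0, hp⟩⟩

/-- An edge exists, so the trace, which is the sum of the eigenvalues, is positive. -/
theorem lambdaMax_pos (hconn : net.graph.Connected) (hp : 2 ≤ p) : 0 < net.lambdaMax := by
  have hne : (⟨0, by omega⟩ : Fin p) ≠ ⟨1, by omega⟩ := by simp
  have : Nontrivial (Fin p) := ⟨⟨_, _, hne⟩⟩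
  obtain ⟨j, hj⟩ := hconn.preconnected.exists_adj_of_nontrivial (⟨0, by omega⟩ : Fin p)
  have htr : 0 < net.laplacian.trace := by
    rw [Matrix.trace]
    simp only [laplacian, Matrix.diag_apply, Matrix.sub_apply, Matrix.diagonal_apply_eq,
      weight_self, sub_zero]
    refine Finset.sum_pos' (fun i _ => Finset.sum_nonneg fun j _ => net.weight_nonneg i j)
      ⟨_, Finset.mem_univ _, Finset.sum_pos' (fun j _ => net.weight_nonneg _ j)
        ⟨j, Finset.mem_univ _, net.weight_pos _ _ hj⟩⟩
  rw [net.laplacian_isHermitian.trace_eq_sum_eigenvalues] at htr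
  obtain ⟨i, _, hi⟩ := Finset.exists_lt_of_sum_lt (s := Finset.univ) (f := fun _ : Fin p => (0:ℝ))
    (g := net.laplacian_isHermitian.eigenvalues) (by simpa using htr)
  exact hi.trans_le (le_csSup spectrum_laplacian_finite.bddAbove
    (net.laplacian_isHermitian.eigenvalues_mem_spectrum_real i))

end Network

/-! ### Convergence of the tracking algorithm -/

theorem exists_diagonalization {p : ℕ} {M : Matrix (Fin p) (Fin p) ℝ} (hM : M.IsHermitian) :
    ∃ (P Q : Matrix (Fin p) (Fin p) ℝ) (l : Fin p → ℝ), P * Q = 1 ∧ Q * M = Matrix.diagonal l * Q ∧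
      ∀ i, l i ∈ spectrum ℝ M := by
  have hs := hM.spectral_theorem
  rw [Unitary.conjStarAlgAut_apply] at hs
  have h2 : star (hM.eigenvectorUnitary : Matrix (Fin p) (Fin p) ℝ) *
      (hM.eigenvectorUnitary : Matrix (Fin p) (Fin p) ℝ) = 1 :=
    Unitary.coe_star_mul_self hM.eigenvectorUnitary
  refine ⟨hM.eigenvectorUnitary, star (hM.eigenvectorUnitary : Matrix (Fin p) (Fin p) ℝ),
    hM.eigenvalues, Unitary.coe_mul_star_self hM.eigenvectorUnitary, ?_,
    hM.eigenvalues_mem_spectrum_real⟩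
  nth_rewrite 2 [hs]
  rw [← mul_assoc, ← mul_assoc, h2, one_mul]
  rfl

section Null

variable {ι κ α : Type*} [Fintype α] {l : Filter ℕ}

theorem tendsto_matrix_zero {M : ℕ → Matrix ι κ ℝ} :
    Tendsto M l (𝓝 0) ↔ ∀ i, Tendsto (fun t => M t i) l (𝓝 0) :=
  tendsto_pi_nhds

theorem tendsto_const_mul_zero (G : Matrix ι α ℝ) {M : ℕ → Matrix α κ ℝ}
    (h : Tendsto M l (𝓝 0)) : Tendsto (fun t => G * M t) l (𝓝 0) := by
  have : Continuous fun X : Matrix α κ ℝ => G * X := continuous_const.matrix_mul continuous_id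
  have h1 := (this.tendsto 0).comp h
  rwa [Matrix.mul_zero] at h1

end Null

section Tracking

variable {p N : ℕ} {q : ℝ[X]}

/-- The rows decouple, each with its own scalar shift of the companion matrix. -/
theorem tendsto_zero_of_diagonal_shift (hq : q.Monic) (hN : q.natDegree = N) (c : Fin p → ℝ)
    (hroot : ∀ i, ∀ z : ℂ, aeval z q = 0 → ‖z - c i‖ < 1) {M : ℕ → Matrix (Fin p) (Fin N) ℝ}
    (h : Tendsto (fun t => M (t + 1) - (M t * (companion N q).transpose - Matrix.diagonal c * M t))
      atTop (𝓝 0)) : Tendsto M atTop (𝓝 0) := by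
  rw [tendsto_matrix_zero] at h ⊢
  intro i
  refine tendsto_zero_of_companion_sub hq hN (c i) (hroot i) ((h i).congr fun t => ?_)
  ext k
  rw [Matrix.sub_apply, Matrix.sub_apply, Matrix.diagonal_mul]
  simp only [Pi.sub_apply, Pi.smul_apply, smul_eq_mul, Matrix.mul_apply, Matrix.transpose_apply, Matrix.mulVec, dotProduct]
  simp only [mul_comm]

/-- One channel of the tracking algorithm in matrix form (row `i` of `W t`, `b t`, `φ t` belongs to
node `i`), with `k_P = 1`: each node tracks the mean of the inputs, provided that these follow the
companion dynamics up to a vanishing error. -/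
theorem tendsto_tracking {net : Network p} (hconn : net.graph.Connected) (hq : q.Monic)
    (hN : q.natDegree = N) {k : ℝ} (hone : ∀ z : ℂ, aeval z q = 0 → ‖z - 1‖ < 1)
    (hroot : ∀ l ∈ spectrum ℝ net.laplacian, l ≠ 0 → ∀ z : ℂ, aeval z q = 0 →
      ‖z - ((2 * k ^ 2 * l ^ 2 : ℝ) : ℂ)‖ < 1)
    {W b φ : ℕ → Matrix (Fin p) (Fin N) ℝ}
    (hW : ∀ t, W (t + 1) = W t * (companion N q).transpose - W t +
      (2 * k) • (net.laplacian * (b t - k • (net.laplacian * W t))) + φ t)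
    (hb : ∀ t, b (t + 1) = b t * (companion N q).transpose - k • (net.laplacian * W t))
    (hφ : Tendsto (fun t => φ (t + 1) - φ t * (companion N q).transpose) atTop (𝓝 0)) :
    Tendsto (fun t => (p : ℝ) • W t - (Matrix.of fun _ _ => 1 : Matrix (Fin p) (Fin p) ℝ) * φ t)
      atTop (𝓝 0) := by
  set F := (companion N q).transpose
  set R := net.laplacian with hR
  -- In this combination the Laplacian terms of the two updates cancel.
  set c : ℕ → Matrix (Fin p) (Fin N) ℝ := fun t => W t - (2 * k) • (R * b t) with hc
  have hc1 : ∀ t, c (t + 1) = c t * F - c t + φ t := by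
    intro t
    simp only [hc, hW, hb, Matrix.mul_sub, Matrix.sub_mul, Matrix.mul_smul, Matrix.smul_mul, smul_sub, Matrix.mul_assoc]
    module
  have he : Tendsto (fun t => c t - φ t) atTop (𝓝 0) := by
    refine tendsto_zero_of_diagonal_shift hq hN (fun _ => 1) (fun _ z hz => by simpa using hone z hz)
      ?_
    have := hφ.neg
    rw [neg_zero] at this
    refine this.congr fun t => ?_
    rw [hc1, Matrix.diagonal_one, Matrix.one_mul, Matrix.sub_mul (c t) (φ t)]
    abel
  obtain ⟨P, Q, l, hPQ, hQR, hl⟩ := exists_diagonalization net.laplacian_isHermitian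
  -- The rows are the eigenmodes of the disagreement RW.
  set g : ℕ → Matrix (Fin p) (Fin N) ℝ := fun t => Q * (R * W t) with hg
  have hg0 : ∀ t i, l i = 0 → g t i = 0 := by
    intro t i hi
    ext j
    rw [hg]
    dsimp only
    rw [← Matrix.mul_assoc, hQR, Matrix.mul_assoc, Matrix.diagonal_mul, hi, zero_mul]; rfl
  have hg1 : ∀ t, g (t + 1) = g t * F - Matrix.diagonal (fun i => 2 * k ^ 2 * l i ^ 2) * g t
      - (Q * R) * (c t - φ t) := by
    intro t
    have hd : Matrix.diagonal (fun i => 2 * k ^ 2 * l i ^ 2) * g t =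
        (2 * k ^ 2) • (Q * R * (R * (R * W t))) := by
      have : Matrix.diagonal (fun i => 2 * k ^ 2 * l i ^ 2) =
          (2 * k ^ 2) • (Matrix.diagonal l * Matrix.diagonal l) := by
        rw [Matrix.diagonal_mul_diagonal, ← Matrix.diagonal_smul]
        congr 1; funext i; simp [sq]
      rw [this, Matrix.smul_mul, hg]
      congr 1
      simp only [← Matrix.mul_assoc]
      rw [Matrix.mul_assoc _ Q R, hQR, ← Matrix.mul_assoc, Matrix.mul_assoc _ Q R, hQR,
        ← Matrix.mul_assoc, Matrix.mul_assoc _ Q R, hQR, ← Matrix.mul_assoc]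
    rw [hd]
    simp only [hg, hc, hW, Matrix.mul_sub, Matrix.mul_add, Matrix.mul_smul, Matrix.mul_assoc, smul_sub]
    module
  have hgt : Tendsto g atTop (𝓝 0) := by
    -- The modes with eigenvalue 0 vanish identically, so their shift can be chosen at will. The
    -- true shift 0 would leave the unstable matrix F; the value 1 is stable by `hone`.
    refine tendsto_zero_of_diagonal_shift hq hN
      (fun i => if l i = 0 then 1 else 2 * k ^ 2 * l i ^ 2) (fun i z hz => ?_) ?_
    · split_ifs with h
      · simpa using hone z hz
      · exact hroot (l i) (hl i) h z hz
    · have := (tendsto_const_mul_zero (Q * R) he).neg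
      rw [neg_zero] at this
      refine this.congr fun t => ?_
      rw [hg1]
      have : Matrix.diagonal (fun i => if l i = 0 then 1 else 2 * k ^ 2 * l i ^ 2) * g t =
          Matrix.diagonal (fun i => 2 * k ^ 2 * l i ^ 2) * g t := by
        ext i j
        rw [Matrix.diagonal_mul, Matrix.diagonal_mul]
        split_ifs with h
        · rw [hg0 t i h]; simp
        · rfl
      rw [this]
      abel
  have hRW : Tendsto (fun t => R * W t) atTop (𝓝 0) := by
    refine (tendsto_const_mul_zero P hgt).congr fun t => ?_
    simp only [hg]
    rw [← Matrix.mul_assoc, hPQ, Matrix.one_mul]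
  -- With J the all-ones matrix, JR = 0 gives pW - Jφ = G(RW) + J(c - φ), and both terms vanish
  -- asymptotically.
  obtain ⟨G, hG⟩ := Network.exists_mul_laplacian hconn
  have h1 := (tendsto_const_mul_zero G hRW).add
    (tendsto_const_mul_zero (Matrix.of fun _ _ => 1 : Matrix (Fin p) (Fin p) ℝ) he)
  rw [add_zero] at h1
  refine h1.congr fun t => ?_
  have hJ : (Matrix.of fun _ _ => 1 : Matrix (Fin p) (Fin p) ℝ) * R = 0 := by
    ext i j
    exact congrFun net.one_vecMul_laplacian j
  rw [← Matrix.mul_assoc, hG]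
  simp only [hc, Matrix.mul_sub, Matrix.sub_mul, Matrix.mul_smul, ← Matrix.mul_assoc, hJ, Matrix.smul_mul, Matrix.one_mul, Matrix.zero_mul,
    smul_zero]
  abel

end Tracking

/-! ### Observability of the unstable subspace -/

/-- Take an annihilator of `x` of least degree and split off a root: the cofactor does not kill `x`,
and yields an eigenvector inside the cyclic subspace of `x`. -/
theorem exists_eigenvector_of_aeval_apply_eq_zero {K M : Type*} [Field K] [IsAlgClosed K]
    [AddCommGroup M] [Module K M] (T : Module.End K M) {x : M} (hx : x ≠ 0) {f : K[X]}
    (hf : f ≠ 0) (hfx : aeval T f x = 0) :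
    ∃ (r : K[X]) (μ : K), aeval T r x ≠ 0 ∧ T (aeval T r x) = μ • aeval T r x ∧ f.IsRoot μ := by
  classical
  have hex : ∃ d, ∃ g : K[X], g ≠ 0 ∧ aeval T g x = 0 ∧ g.natDegree = d := ⟨_, f, hf, hfx, rfl⟩
  obtain ⟨g, hg, hgx, hd⟩ := Nat.find_spec hex
  have hdeg : g.degree ≠ 0 := by
    intro h
    rw [eq_C_of_degree_eq_zero h, aeval_C, Module.algebraMap_end_apply] at hgx
    refine (smul_eq_zero.1 hgx).elim (fun h0 => ?_) hx
    rw [eq_C_of_degree_eq_zero h, h0, C_0] at hg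
    exact hg rfl
  obtain ⟨μ, hμ⟩ := IsAlgClosed.exists_root g hdeg
  obtain ⟨r, hr⟩ := dvd_iff_isRoot.2 hμ
  have hr0 : r ≠ 0 := by rintro rfl; simp at hr; exact hg hr
  have hw : aeval T r x ≠ 0 := by
    intro h
    refine Nat.find_min hex (m := r.natDegree) ?_ ⟨r, hr0, h, rfl⟩
    rw [← hd, hr, natDegree_mul (X_sub_C_ne_zero μ) hr0, natDegree_X_sub_C]
    omega
  have hT : T (aeval T r x) = μ • aeval T r x := by
    rw [hr, map_mul, Module.End.mul_apply] at hgx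
    simpa [sub_eq_zero, Module.algebraMap_end_apply] using hgx
  refine ⟨r, μ, hw, hT, ?_⟩
  have h1 : aeval T f (aeval T r x) = f.eval μ • aeval T r x :=
    Module.End.aeval_apply_of_hasEigenvector ⟨Module.End.mem_eigenspace_iff.2 hT, hw⟩
  rw [← Module.End.mul_apply, ← map_mul, mul_comm, map_mul, Module.End.mul_apply, hfx, map_zero] at h1
  exact (smul_eq_zero.1 h1.symm).resolve_right hw

theorem map_ofReal_mulVec {m n : ℕ} (M : Matrix (Fin m) (Fin n) ℝ) (x : Fin n → ℝ) :
    (M.map (fun r : ℝ => (r : ℂ))).mulVec (fun i => (x i : ℂ)) = fun i => ((M.mulVec x i : ℝ) : ℂ) := by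
  funext i
  simp [Matrix.mulVec, dotProduct]

theorem aeval_mulVec {K : Type*} [CommRing K] {n : ℕ} (A : Matrix (Fin n) (Fin n) K) (q : K[X])
    (x : Fin n → K) :
    (aeval A q).mulVec x = ∑ k ∈ Finset.range (q.natDegree + 1), q.coeff k • (A ^ k).mulVec x := by
  rw [aeval_eq_sum_range, Matrix.sum_mulVec]
  simp [Matrix.smul_mulVec]

section Observability

variable {n : ℕ} {A : Matrix (Fin n) (Fin n) ℝ}

theorem mem_unstableSubspace {x : Fin n → ℝ} :
    x ∈ unstableSubspace A ↔ (aeval A (unstablePoly A)).mulVec x = 0 := Iff.rfl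

/-- An unstable state whose first outputs vanish is zero if the system is detectable. -/
theorem eq_zero_of_detectable {m : ℕ} {C : Matrix (Fin m) (Fin n) ℝ} (hdet : Detectable A C)
    {x : Fin n → ℝ} (hx : x ∈ unstableSubspace A)
    (h : ∀ k < unstableDim A, (C * A ^ k).mulVec x = 0) : x = 0 := by
  by_contra hx0
  -- Reduction modulo the unstable factor, which kills `x`, leaves only powers of `A` below N, whose
  -- outputs vanish by assumption.
  have hpoly : ∀ g : ℝ[X], C.mulVec ((aeval A g).mulVec x) = 0 := by
    intro g
    have h1 : (aeval A g).mulVec x = (aeval A (g %ₘ unstablePoly A)).mulVec x := by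
      conv_lhs => rw [← modByMonic_add_div g (unstablePoly A)]
      rw [map_add, mul_comm, map_mul, Matrix.add_mulVec, ← Matrix.mulVec_mulVec,
        mem_unstableSubspace.1 hx, Matrix.mulVec_zero, add_zero]
    rw [h1, aeval_mulVec, Matrix.mulVec_sum]
    refine Finset.sum_eq_zero fun k _ => ?_
    rw [Matrix.mulVec_smul, Matrix.mulVec_mulVec]
    by_cases hk : k < unstableDim A
    · rw [h k hk, smul_zero]
    · have h2 : (g %ₘ unstablePoly A).coeff k = 0 := by
        refine coeff_eq_zero_of_degree_lt
          ((degree_modByMonic_lt g (unstablePoly_monic A)).trans_le ?_)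
        rw [degree_eq_natDegree (unstablePoly_monic A).ne_zero]
        exact_mod_cast not_lt.1 hk
      rw [h2, zero_smul]
  set Ac := A.map (fun r : ℝ => (r : ℂ)) with hAc
  set xc : Fin n → ℂ := fun i => (x i : ℂ) with hxc
  have hpow : ∀ k, (Ac ^ k).mulVec xc = fun i => (((A ^ k).mulVec x i : ℝ) : ℂ) := by
    intro k
    have : Ac ^ k = (A ^ k).map (fun r : ℝ => (r : ℂ)) :=
      (map_pow (algebraMap ℝ ℂ).mapMatrix A k).symm
    rw [this, map_ofReal_mulVec]
  have haev : ∀ f : ℂ[X], aeval Ac.mulVecLin f xc = (aeval Ac f).mulVec xc := by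
    intro f
    rw [← Matrix.toLin'_apply', ← Matrix.toLinAlgEquiv'_apply (aeval Ac f),
      ← AlgEquiv.coe_toAlgHom, ← aeval_algHom_apply]
    rfl
  -- The cyclic subspace of `x` is now unobservable; an eigenvector in it has an unstable
  -- eigenvalue, against detectability.
  obtain ⟨r, μ, hw, hT, hroot⟩ := exists_eigenvector_of_aeval_apply_eq_zero Ac.mulVecLin
    (x := xc) (f := (unstablePoly A).map (algebraMap ℝ ℂ))
    (fun h0 => hx0 (funext fun i => by simpa [hxc] using congrFun h0 i))
    (map_ne_zero (unstablePoly_monic A).ne_zero) (by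
      rw [haev, aeval_mulVec, natDegree_map]
      simp only [hpow]
      have h1 := mem_unstableSubspace.1 hx
      rw [aeval_mulVec] at h1
      funext i
      have h2 := congrArg (fun a : ℝ => (a : ℂ)) (congrFun h1 i)
      simpa using h2)
  rw [IsRoot, eval_map_algebraMap] at hroot
  refine (hdet μ _ hw hT ?_).not_ge (one_le_norm_of_aeval_unstablePoly hroot)
  rw [haev, aeval_mulVec, Matrix.mulVec_sum]
  refine Finset.sum_eq_zero fun k _ => ?_
  have h1 := hpoly (X ^ k)
  rw [map_pow, aeval_X] at h1
  rw [Matrix.mulVec_smul, hpow, map_ofReal_mulVec, h1]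
  simp [← Pi.zero_def]

end Observability

/-! ### Sparse detectability -/

theorem mem_span_single_iff {p : ℕ} {V : Finset (Fin p)} {u : Fin p → ℝ} :
    u ∈ Submodule.span ℝ ((fun i : Fin p => (Pi.single i (1 : ℝ) : Fin p → ℝ)) '' (V : Set (Fin p)))
      ↔ ∀ i ∉ V, u i = 0 := by
  constructor
  · intro hu i hi
    induction hu using Submodule.span_induction with
    | mem x hx =>
      obtain ⟨j, hj, rfl⟩ := hx
      exact Pi.single_eq_of_ne (by rintro rfl; exact hi hj) _
    | zero => rfl
    | add x y _ _ hx hy => simp [hx, hy]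
    | smul a x _ hx => simp [hx]
  · intro h
    have : u = ∑ i ∈ V, u i • (Pi.single i (1 : ℝ) : Fin p → ℝ) := by
      funext j
      rw [Finset.sum_apply]
      by_cases hj : j ∈ V
      · rw [Finset.sum_eq_single j (fun i _ hij => by simp [hij.symm])
          (fun h => absurd hj h)]
        simp
      · rw [h j hj, Finset.sum_eq_zero]
        intro i hi
        have : j ≠ i := fun h => hj (h ▸ hi)
        simp [this]
    rw [this]
    exact Submodule.sum_mem _ fun i hi =>
      Submodule.smul_mem _ _ (Submodule.subset_span ⟨i, hi, rfl⟩)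

/-- If LCw = 0, then the real and imaginary parts of Cw lie in the kernel of `L`, so they are
supported on `V`, and `w` is invisible to the sensors outside `V`. -/
theorem SparseDetectable.wrt_one {p n k : ℕ} {A : Matrix (Fin n) (Fin n) ℝ}
    {C : Matrix (Fin p) (Fin n) ℝ} (hdet : SparseDetectable A C k) :
    SparseDetectableWrt A C (1 : Matrix (Fin p) (Fin p) ℝ) k := by
  intro V hV m L hL μ w hw hAw hLw
  rw [Matrix.mulVecLin_one, Submodule.map_id] at hL
  refine hdet Vᶜ ?_ μ w hw hAw ?_
  · rw [Finset.card_compl, Fintype.card_fin]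
    omega
  rw [Matrix.mul_one] at hLw
  have hpart : ∀ f : ℂ →ₗ[ℝ] ℝ, ∀ i ∉ V, f ((C.map (fun r : ℝ => (r : ℂ))).mulVec w i) = 0 := by
    intro f
    have h1 : ∀ {m' n' : ℕ} (M : Matrix (Fin m') (Fin n') ℝ) (u : Fin n' → ℂ),
        M.mulVec (fun i => f (u i)) = fun i => f ((M.map (fun r : ℝ => (r : ℂ))).mulVec u i) := by
      intro m' n' M u
      funext i
      simp only [Matrix.mulVec, dotProduct, Matrix.map_apply, map_sum]
      refine Finset.sum_congr rfl fun j _ => ?_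
      rw [← Complex.real_smul, map_smul, smul_eq_mul]
    have h2 : (C.mulVec fun i => f (w i)) ∈ LinearMap.ker L.mulVecLin := by
      rw [LinearMap.mem_ker, Matrix.mulVecLin_apply, Matrix.mulVec_mulVec, h1, hLw]
      simp [← Pi.zero_def]
    rw [hL, mem_span_single_iff, h1] at h2
    exact h2
  funext i
  have hi : (i : Fin p) ∉ V := Finset.mem_compl.1 i.2
  exact Complex.ext (hpart Complex.reLm i hi) (hpart Complex.imLm i hi)

/-- The matrix is the quotient map by `S`, written in a basis. -/
theorem exists_matrix_ker_eq {v : ℕ} (S : Submodule ℝ (Fin v → ℝ)) :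
    ∃ (m : ℕ) (L : Matrix (Fin m) (Fin v) ℝ), LinearMap.ker L.mulVecLin = S := by
  refine ⟨_, LinearMap.toMatrix' ((Module.finBasis ℝ ((Fin v → ℝ) ⧸ S)).equivFun.toLinearMap.comp
    S.mkQ), ?_⟩
  rw [← Matrix.toLin'_apply', Matrix.toLin'_toMatrix', LinearEquiv.ker_comp, Submodule.ker_mkQ]

/-! ### The reconstruction step -/

theorem blockSparse_iff {p N s : ℕ} {E : Fin p → Fin N → ℝ} :
    BlockSparse s E ↔ ∃ V : Finset (Fin p), V.card ≤ s ∧ ∀ i ∉ V, E i = 0 := by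
  classical
  unfold BlockSparse
  constructor
  · intro h
    refine ⟨Finset.univ.filter fun i => E i ≠ 0, ?_, by simp⟩
    rw [← Set.ncard_coe_finset]
    simpa using h
  · rintro ⟨V, hV, h⟩
    refine le_trans ?_ hV
    rw [← Set.ncard_coe_finset]
    exact Set.ncard_le_ncard (fun i hi => by_contra fun hn => hi (h i hn)) V.finite_toSet

section Reconstruction

variable {p n v N s : ℕ} (A : Matrix (Fin n) (Fin n) ℝ) (C : Matrix (Fin p) (Fin n) ℝ)
  (D : Matrix (Fin v) (Fin p) ℝ)

/-- `compressed` as a linear map. -/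
def compressedLin (N : ℕ) :
    (Fin n → ℝ) × (Fin p → Fin N → ℝ) →ₗ[ℝ] (Fin v → Fin N → ℝ) where
  toFun w := compressed A C D w.1 w.2
  map_add' w w' := by
    funext j k
    simp only [compressed, Prod.fst_add, Prod.snd_add, Matrix.mulVec_add, Pi.add_apply,
      ← Finset.sum_add_distrib]
    exact Finset.sum_congr rfl fun i _ => by ring
  map_smul' c w := by
    funext j k
    simp only [compressed, Prod.smul_fst, Prod.smul_snd, Matrix.mulVec_smul, Pi.smul_apply,
      smul_eq_mul, Finset.mul_sum, RingHom.id_apply]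
    exact Finset.sum_congr rfl fun i _ => by ring

theorem compressedLin_apply (w : (Fin n → ℝ) × (Fin p → Fin N → ℝ)) :
    compressedLin A C D N w = compressed A C D w.1 w.2 := rfl

/-- Pairs of an unstable state and a stacked attack supported on `V`. -/
def supported (V : Finset (Fin p)) :
    Submodule ℝ ((Fin n → ℝ) × (Fin p → Fin (unstableDim A) → ℝ)) where
  carrier := {w | w.1 ∈ unstableSubspace A ∧ ∀ i ∉ V, w.2 i = 0}
  add_mem' ha hb := ⟨add_mem ha.1 hb.1, fun i hi => by simp [ha.2 i hi, hb.2 i hi]⟩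
  zero_mem' := ⟨zero_mem _, fun _ _ => rfl⟩
  smul_mem' c w hw := ⟨Submodule.smul_mem _ _ hw.1, fun i hi => by simp [hw.2 i hi]⟩

variable {A C D}

/-- A matrix `L` with kernel D(span V) erases every attack supported on `V`, so `x` has zero outputs
for the detectable pair (A, LDC). -/
theorem eq_zero_of_compressed_eq_zero {k : ℕ} (hD : SparseDetectableWrt A C D k)
    {V : Finset (Fin p)} (hV : V.card ≤ k) {x : Fin n → ℝ} (hx : x ∈ unstableSubspace A)
    {E : Fin p → Fin (unstableDim A) → ℝ} (hE : ∀ i ∉ V, E i = 0)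
    (h : compressed A C D x E = 0) : x = 0 := by
  obtain ⟨m, L, hL⟩ := exists_matrix_ker_eq (Submodule.map D.mulVecLin
        (Submodule.span ℝ ((fun i : Fin p => (Pi.single i (1 : ℝ) : Fin p → ℝ)) '' (V : Set (Fin p)))))
  refine eq_zero_of_detectable (hD V hV m L hL) hx fun k hk => ?_
  have h1 : D.mulVec ((C * A ^ k).mulVec x) = D.mulVec (-fun i => E i ⟨k, hk⟩) := by
    rw [Matrix.mulVec_neg, eq_neg_iff_add_eq_zero, ← Matrix.mulVec_add]
    funext j
    exact congrFun (congrFun h j) ⟨k, hk⟩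
  have h2 : D.mulVec (-fun i => E i ⟨k, hk⟩) ∈ LinearMap.ker L.mulVecLin := by
    rw [hL]
    refine Submodule.mem_map_of_mem (f := D.mulVecLin) (mem_span_single_iff.2 fun i hi => ?_)
    simp [hE i hi]
  rw [Matrix.mul_assoc, Matrix.mul_assoc, ← Matrix.mulVec_mulVec, ← Matrix.mulVec_mulVec, h1]
  exact h2

/-- Only the state is recovered; the attack need not be determined by the compressed output. -/
theorem exists_leftInverse_compressed {k : ℕ} (hD : SparseDetectableWrt A C D k)
    {V : Finset (Fin p)} (hV : V.card ≤ k) :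
    ∃ g : (Fin v → Fin (unstableDim A) → ℝ) →ₗ[ℝ] (Fin n → ℝ),
      ∀ w ∈ supported A V, g (compressed A C D w.1 w.2) = w.1 := by
  obtain ⟨g, hg⟩ := exists_comp_eq_of_ker_le
    ((compressedLin A C D (unstableDim A)).comp (supported A V).subtype)
    ((LinearMap.fst ℝ _ _).comp (supported A V).subtype) (by
      rintro ⟨w, hw⟩ h
      exact eq_zero_of_compressed_eq_zero hD hV hw.1 hw.2 h)
  exact ⟨g, fun w hw => hg ⟨w, hw⟩⟩

/-- The support may change with time, but there are finitely many candidates: summing the norms of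
all the left inverses gives one vanishing bound. -/
theorem tendsto_zero_of_compressed {k : ℕ} (hD : SparseDetectableWrt A C D k)
    {z : ℕ → Fin n → ℝ} {E : ℕ → Fin p → Fin (unstableDim A) → ℝ}
    (hz : ∀ t, z t ∈ unstableSubspace A) (hE : ∀ t, BlockSparse k (E t))
    (h : Tendsto (fun t => compressed A C D (z t) (E t)) atTop (𝓝 0)) :
    Tendsto z atTop (𝓝 0) := by
  choose V hV hEV using fun t => blockSparse_iff.1 (hE t)
  choose g hg using fun V : {V : Finset (Fin p) // V.card ≤ k} =>
    exists_leftInverse_compressed hD V.2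
  have h1 : Tendsto (fun t => ∑ V, ‖g V (compressed A C D (z t) (E t))‖) atTop (𝓝 0) := by
    rw [← Finset.sum_const_zero (ι := {V : Finset (Fin p) // V.card ≤ k}) (s := Finset.univ)]
    refine tendsto_finsetSum _ fun V _ => ?_
    have h2 := ((LinearMap.continuous_of_finiteDimensional (g V)).tendsto 0).comp h
    rw [map_zero] at h2
    exact tendsto_zero_iff_norm_tendsto_zero.1 h2
  refine squeeze_zero_norm (fun t => ?_) h1
  have h2 := hg ⟨V t, hV t⟩ (z t, E t) ⟨hz t, hEV t⟩
  calc ‖z t‖ = ‖g ⟨V t, hV t⟩ (compressed A C D (z t) (E t))‖ := by rw [h2]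
    _ ≤ _ := Finset.single_le_sum
      (f := fun V => ‖g V (compressed A C D (z t) (E t))‖) (fun _ _ => norm_nonneg _)
      (Finset.mem_univ _)

/-- Stacked vectors as elements of a Euclidean space. -/
def stackEquiv (v N : ℕ) : (Fin v → Fin N → ℝ) ≃ₗ[ℝ] EuclideanSpace ℝ (Fin v × Fin N) :=
  (LinearEquiv.curry ℝ ℝ (Fin v) (Fin N)).symm.trans (WithLp.linearEquiv 2 ℝ _).symm

theorem stackNorm_eq (W : Fin v → Fin N → ℝ) : stackNorm W = ‖stackEquiv v N W‖ := by
  rw [EuclideanSpace.norm_eq, stackNorm, Fintype.sum_prod_type]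
  simp [stackEquiv]

theorem tendsto_stackNorm_zero {W : ℕ → Fin v → Fin N → ℝ} :
    Tendsto (fun t => stackNorm (W t)) atTop (𝓝 0) ↔ Tendsto W atTop (𝓝 0) := by
  simp only [stackNorm_eq, ← tendsto_zero_iff_norm_tendsto_zero]
  constructor
  · intro h
    have := ((LinearMap.continuous_of_finiteDimensional
      (stackEquiv v N).symm.toLinearMap).tendsto 0).comp h
    rw [map_zero] at this
    exact this.congr fun t => (stackEquiv v N).symm_apply_apply _
  · intro h
    have := ((LinearMap.continuous_of_finiteDimensional
      (stackEquiv v N).toLinearMap).tendsto 0).comp h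
    rwa [map_zero] at this

/-- The feasible outputs form a finite union of finite-dimensional subspaces. It is not convex in
general, but it is closed, so a nearest point exists. -/
theorem exists_isReconstruction (W : Fin v → Fin (unstableDim A) → ℝ) :
    ∃ z, IsReconstruction A C D s W z := by
  set f := (stackEquiv v (unstableDim A)).toLinearMap.comp (compressedLin A C D (unstableDim A))
  set R : Set (EuclideanSpace ℝ (Fin v × Fin (unstableDim A))) :=
    ⋃ V ∈ {V : Finset (Fin p) | V.card ≤ s}, ((supported A V).map f : Set _) with hR
  have hcl : IsClosed R := Set.Finite.isClosed_biUnion (Set.toFinite _) fun V _ =>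
    Submodule.closed_of_finiteDimensional _
  have hmem : ∀ z ∈ unstableSubspace A, ∀ E : Fin p → Fin (unstableDim A) → ℝ, BlockSparse s E →
      stackEquiv v (unstableDim A) (compressed A C D z E) ∈ R := by
    intro z hz E hE
    obtain ⟨V, hV, hEV⟩ := blockSparse_iff.1 hE
    exact Set.mem_biUnion (x := V) hV ⟨(z, E), ⟨hz, hEV⟩, rfl⟩
  have hne : R.Nonempty :=
    ⟨_, hmem 0 (zero_mem _) 0 (blockSparse_iff.2 ⟨∅, by simp, fun _ _ => rfl⟩)⟩
  obtain ⟨y, hy, hdist⟩ := hcl.exists_infDist_eq_dist hne (stackEquiv v _ ((p : ℝ) • W))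
  rw [hR, Set.mem_iUnion₂] at hy
  obtain ⟨V, hV, ⟨z, E⟩, ⟨hz, hEV⟩, rfl⟩ := hy
  refine ⟨z, hz, E, blockSparse_iff.2 ⟨V, hV, hEV⟩, fun z' hz' E' hE' => ?_⟩
  rw [stackNorm_eq, stackNorm_eq, map_sub, map_sub, ← dist_eq_norm, ← dist_eq_norm]
  exact hdist.symm.trans_le (Metric.infDist_le_dist_of_mem (hmem z' hz' E' hE'))

/-- Reconstruction from an asymptotically correct compressed measurement yields the state, up to
its stable part. -/
theorem tendsto_reconstruction (hD : SparseDetectableWrt A C D (2 * s))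
    {W : ℕ → Fin v → Fin (unstableDim A) → ℝ} {z u r : ℕ → Fin n → ℝ}
    {E : ℕ → Fin p → Fin (unstableDim A) → ℝ} (hz : ∀ t, IsReconstruction A C D s (W t) (z t))
    (hu : ∀ t, u t ∈ unstableSubspace A) (hr : Tendsto r atTop (𝓝 0))
    (hE : ∀ t, BlockSparse s (E t))
    (h : Tendsto (fun t => (p : ℝ) • W t - compressed A C D (u t + r t) (E t)) atTop (𝓝 0)) :
    Tendsto (fun t => z t - (u t + r t)) atTop (𝓝 0) := by
  choose hzU F hF hmin using hz
  have h1 : Tendsto (fun t => compressed A C D (r t) (0 : Fin p → Fin (unstableDim A) → ℝ)) atTop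
      (𝓝 0) := by
    have h2 := ((LinearMap.continuous_of_finiteDimensional ((compressedLin A C D (unstableDim A)).comp
      (LinearMap.inl ℝ _ _))).tendsto 0).comp hr
    rwa [map_zero] at h2
  -- The minimization admits only unstable states, so the comparison point is `u` rather than `u +
  -- r`; the output of `r` vanishes.
  have h2 : Tendsto (fun t => (p : ℝ) • W t - compressed A C D (u t) (E t)) atTop (𝓝 0) := by
    have h3 := h.add h1
    rw [add_zero] at h3
    refine h3.congr fun t => ?_
    have : compressed A C D (u t + r t) (E t) = compressed A C D (u t) (E t) +
        compressed A C D (r t) 0 := by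
      have := map_add (compressedLin A C D (unstableDim A)) (u t, E t) (r t, 0)
      simpa [compressedLin_apply] using this
    rw [this]
    abel
  have h3 : Tendsto (fun t => (p : ℝ) • W t - compressed A C D (z t) (F t)) atTop (𝓝 0) := by
    rw [← tendsto_stackNorm_zero] at h2 ⊢
    exact squeeze_zero (fun t => Real.sqrt_nonneg _) (fun t => hmin t _ (hu t) _ (hE t)) h2
  have h4 : Tendsto (fun t => compressed A C D (z t - u t) (F t - E t)) atTop (𝓝 0) := by
    have h5 := h2.sub h3
    rw [sub_zero] at h5
    refine h5.congr fun t => ?_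
    have := map_sub (compressedLin A C D (unstableDim A)) (z t, F t) (u t, E t)
    simp only [compressedLin_apply, Prod.mk_sub_mk] at this
    rw [this]
    abel
  have h5 := tendsto_zero_of_compressed hD (fun t => sub_mem (hzU t) (hu t)) (fun t => ?_) h4
  · have h6 := h5.sub hr
    rw [sub_zero] at h6
    exact h6.congr fun t => by abel
  -- Subtracting two s-sparse attacks is what requires detectability at level 2s.
  · obtain ⟨V, hV, hVF⟩ := blockSparse_iff.1 (hF t)
    obtain ⟨V', hV', hVE⟩ := blockSparse_iff.1 (hE t)
    refine blockSparse_iff.2 ⟨V ∪ V', (Finset.card_union_le _ _).trans (by omega), fun i hi => ?_⟩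
    rw [Finset.mem_union, not_or] at hi
    simp [hVF i hi.1, hVE i hi.2]

end Reconstruction

/-! ### Trajectories -/

section Trajectory

variable {n : ℕ} {A : Matrix (Fin n) (Fin n) ℝ} {x : ℕ → Fin n → ℝ}

theorem IsTrajectory.add (hx : IsTrajectory A x) (t k : ℕ) : x (t + k) = (A ^ k).mulVec (x t) := by
  induction k with
  | zero => simp
  | succ k ih => rw [← add_assoc, hx, ih, Matrix.mulVec_mulVec, pow_succ']

theorem IsTrajectory.aeval_shift (hx : IsTrajectory A x) (q : ℝ[X]) (t : ℕ) :
    aeval (shift ℝ (Fin n → ℝ)) q x t = (aeval A q).mulVec (x t) := by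
  rw [aeval_shift_apply, aeval_mulVec]
  simp only [hx.add]

/-- A trajectory is the sum of one in the unstable subspace and a vanishing one. -/
theorem IsTrajectory.exists_decomposition (hx : IsTrajectory A x) :
    ∃ u r : ℕ → Fin n → ℝ, (∀ t, u t ∈ unstableSubspace A) ∧ Tendsto r atTop (𝓝 0) ∧
      ∀ t, x t = u t + r t := by
  -- The Bézout identity yields the two spectral projections as polynomials in `A`.
  obtain ⟨a, b, hab⟩ := isCoprime_unstablePoly_stablePoly A
  have hCH : aeval A (unstablePoly A * stablePoly A) = 0 := by
    rw [unstablePoly_mul_stablePoly, Matrix.aeval_self_charpoly]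
  have hcomm : ∀ g : ℝ[X], aeval A g * A = A * aeval A g := fun g => by
    have := congrArg (aeval A) (mul_comm g X)
    rwa [map_mul, map_mul, aeval_X] at this
  refine ⟨fun t => (aeval A (b * stablePoly A)).mulVec (x t),
    fun t => (aeval A (a * unstablePoly A)).mulVec (x t), fun t => ?_, ?_, fun t => ?_⟩
  · rw [mem_unstableSubspace, Matrix.mulVec_mulVec, ← map_mul,
      show unstablePoly A * (b * stablePoly A) = b * (unstablePoly A * stablePoly A) by ring,
      map_mul, hCH, mul_zero, Matrix.zero_mulVec]
  · have hr : IsTrajectory A fun t => (aeval A (a * unstablePoly A)).mulVec (x t) := by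
      intro t
      simp only [hx t, Matrix.mulVec_mulVec]
      rw [hcomm]
    rw [tendsto_pi_nhds]
    intro i
    refine mem_nullSeq_of_aeval (stablePoly A) (stablePoly_ne_zero A)
      (fun z hz => norm_lt_one_of_aeval_stablePoly hz) ?_
    change aeval (shift ℝ ℝ) (stablePoly A) (fun t => (LinearMap.proj i : (Fin n → ℝ) →ₗ[ℝ] ℝ)
      ((aeval A (a * unstablePoly A)).mulVec (x t))) ∈ _
    rw [aeval_shift_comp (LinearMap.proj i : (Fin n → ℝ) →ₗ[ℝ] ℝ) (stablePoly A)
      (fun t => (aeval A (a * unstablePoly A)).mulVec (x t))]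
    have : (fun t => (LinearMap.proj i : (Fin n → ℝ) →ₗ[ℝ] ℝ) (aeval (shift ℝ (Fin n → ℝ))
        (stablePoly A) (fun t => (aeval A (a * unstablePoly A)).mulVec (x t)) t)) = 0 := by
      funext t
      rw [hr.aeval_shift, Matrix.mulVec_mulVec, ← map_mul,
        show stablePoly A * (a * unstablePoly A) = a * (unstablePoly A * stablePoly A) by ring,
        map_mul, hCH, mul_zero, Matrix.zero_mulVec]
      rfl
    rw [this]
    exact zero_mem _
  · rw [← Matrix.add_mulVec, ← map_add, add_comm, hab, map_one, Matrix.one_mulVec]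

end Trajectory

/-! ### Windows of measurements -/

/-- All coordinates but the last just shift; the last one misses by the defect of the scalar
recursion. -/
theorem companion_mulVec_window {N : ℕ} {q : ℝ[X]} (hq : q.Monic) (hN : q.natDegree = N)
    (Y : ℕ → ℝ) (t : ℕ) (k : Fin N) :
    (companion N q).mulVec (fun k : Fin N => Y (t + k)) k =
      Y (t + 1 + k) - if (k : ℕ) + 1 = N then aeval (shift ℝ ℝ) q Y t else 0 := by
  rw [Matrix.mulVec, dotProduct]
  by_cases hk : (k : ℕ) + 1 < N
  · rw [Finset.sum_eq_single ⟨k + 1, hk⟩, if_neg hk.ne]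
    · simp [companion, hk]
      congr 1
      omega
    · intro j _ hj
      have : (j : ℕ) ≠ k + 1 := fun h => hj (Fin.ext h)
      simp [companion, hk, this]
    · simp
  · have hk' : (k : ℕ) + 1 = N := by have := k.2; omega
    have hlead : q.coeff N = 1 := hN ▸ hq.coeff_natDegree
    rw [if_pos hk', aeval_shift_apply, hN, Finset.sum_range_succ, hlead, Finset.sum_range]
    simp only [companion, if_neg hk, smul_eq_mul, neg_mul, Finset.sum_neg_distrib, one_mul]
    rw [show t + 1 + (k : ℕ) = t + N by omega]
    ring

section Measurements

variable {p n : ℕ} {A : Matrix (Fin n) (Fin n) ℝ} {C : Matrix (Fin p) (Fin n) ℝ}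

/-- The recursion is read off the last coordinate. For n = 0 there is none: the check is void while
the characteristic polynomial is 1. -/
theorem aeval_charpoly_eq_zero_of_passesSanityCheck (hn : 0 < n) {y : ℕ → Fin p → ℝ} {i : Fin p}
    (h : PassesSanityCheck A y i) : aeval (shift ℝ ℝ) A.charpoly (fun t => y t i) = 0 := by
  funext t
  have h1 := congrFun (h t) ⟨n - 1, by omega⟩
  have h2 := companion_mulVec_window (N := n) A.charpoly_monic (by simp) (fun t => y t i) t
    ⟨n - 1, by omega⟩
  rw [if_pos (show n - 1 + 1 = n by omega)] at h2
  unfold window at h1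
  rw [h2] at h1
  dsimp only at h1
  rw [Pi.zero_apply]
  linarith

theorem passesSanityCheck_of_aeval_charpoly_eq_zero {y : ℕ → Fin p → ℝ} {i : Fin p}
    (h : aeval (shift ℝ ℝ) A.charpoly (fun t => y t i) = 0) : PassesSanityCheck A y i := by
  intro t
  funext k
  have h2 := companion_mulVec_window (N := n) A.charpoly_monic (by simp) (fun t => y t i) t k
  rw [h] at h2
  unfold window
  rw [h2]
  simp

/-- By Cayley–Hamilton. -/
theorem passesSanityCheck_of_no_attack {x : ℕ → Fin n → ℝ} (hx : IsTrajectory A x)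
    {e : ℕ → Fin p → ℝ} {i : Fin p} (he : ∀ t, e t i = 0) :
    PassesSanityCheck A (measurement C x e) i := by
  apply passesSanityCheck_of_aeval_charpoly_eq_zero
  have h1 := aeval_shift_comp ((LinearMap.proj i : (Fin p → ℝ) →ₗ[ℝ] ℝ).comp C.mulVecLin)
    A.charpoly x
  have h2 : (fun t => measurement C x e t i) =
      fun t => ((LinearMap.proj i : (Fin p → ℝ) →ₗ[ℝ] ℝ).comp C.mulVecLin) (x t) := by
    funext t
    simp [measurement, he]
  rw [h2, h1]
  funext t
  rw [hx.aeval_shift, Matrix.aeval_self_charpoly, Matrix.zero_mulVec, map_zero]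
  rfl

/-- The stacked measurements of a sensor that passes the sanity check follow the dynamics of the
tracking matrix up to a vanishing error. -/
theorem tendsto_window_of_passesSanityCheck (hn : 0 < n) {y : ℕ → Fin p → ℝ} {i : Fin p}
    (h : PassesSanityCheck A y i) :
    Tendsto (fun t => window (unstableDim A) y (t + 1) i -
      (trackingMatrix A).mulVec (window (unstableDim A) y t i)) atTop (𝓝 0) := by
  -- The stable factor annihilates this defect, so it is null; no absence of attack is used.
  have h1 : aeval (shift ℝ ℝ) (unstablePoly A) (fun t => y t i) ∈ nullSeq ℝ ℝ := by
    refine mem_nullSeq_of_aeval (stablePoly A) (stablePoly_ne_zero A)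
      (fun z hz => norm_lt_one_of_aeval_stablePoly hz) ?_
    rw [← Module.End.mul_apply, ← map_mul, mul_comm, unstablePoly_mul_stablePoly,
      aeval_charpoly_eq_zero_of_passesSanityCheck hn h]
    exact zero_mem _
  rw [tendsto_pi_nhds]
  intro k
  have h2 : ∀ t, (window (unstableDim A) y (t + 1) i -
      (trackingMatrix A).mulVec (window (unstableDim A) y t i)) k =
      if (k : ℕ) + 1 = unstableDim A then
        aeval (shift ℝ ℝ) (unstablePoly A) (fun t => y t i) t else 0 := by
    intro t
    have h3 := companion_mulVec_window (N := unstableDim A) (unstablePoly_monic A) rfl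
      (fun t => y t i) t k
    change y (t + 1 + k) i - (companion (unstableDim A) (unstablePoly A)).mulVec
      (fun k => y (t + k) i) k = _
    rw [h3]
    ring
  simp only [h2]
  split_ifs
  · exact h1
  · exact tendsto_const_nhds

end Measurements

/-! ### The gains -/

theorem norm_sub_ofReal_lt_one_iff (z : ℂ) (c : ℝ) :
    ‖z - c‖ < 1 ↔ (z.re - c) ^ 2 + z.im ^ 2 < 1 := by
  rw [← sq_lt_one_iff₀ (norm_nonneg _), ← Complex.normSq_eq_norm_sq, Complex.normSq_apply]
  simp [sq]

/-- The integral gain. -/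
noncomputable def Network.integralGain {p : ℕ} (net : Network p) : ℝ := (√2 * net.lambdaMax)⁻¹

section Gains

variable {p n : ℕ} {net : Network p} {A : Matrix (Fin n) (Fin n) ℝ}

theorem norm_sub_gain_lt_one (hsamp : SamplingCondition net A) {l : ℝ}
    (hl : l ∈ spectrum ℝ net.laplacian) (hl0 : l ≠ 0) {z : ℂ}
    (hz : aeval z (unstablePoly A) = 0) :
    ‖z - ((2 * net.integralGain ^ 2 * l ^ 2 : ℝ) : ℂ)‖ < 1 := by
  rw [norm_sub_ofReal_lt_one_iff]
  have h := hsamp z (isEigenvalue_of_aeval_unstablePoly hz)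
    (one_le_norm_of_aeval_unstablePoly hz) l hl hl0
  -- The √2 in the gain absorbs the factor 2 of the update of W.
  have e : 2 * net.integralGain ^ 2 * l ^ 2 = l ^ 2 / net.lambdaMax ^ 2 := by
    rw [Network.integralGain, mul_inv, mul_pow, inv_pow, inv_pow, Real.sq_sqrt (by norm_num)]
    ring
  rwa [e]

theorem norm_sub_one_lt_one (hconn : net.graph.Connected) (hsamp : SamplingCondition net A)
    (hone : p = 1 → ∀ μ : ℂ, IsEigenvalue A μ → 1 ≤ ‖μ‖ → (μ.re - 1) ^ 2 + μ.im ^ 2 < 1)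
    {z : ℂ} (hz : aeval z (unstablePoly A) = 0) : ‖z - 1‖ < 1 := by
  have h1 := isEigenvalue_of_aeval_unstablePoly hz
  have h2 := one_le_norm_of_aeval_unstablePoly hz
  have h3 : (z.re - 1) ^ 2 + z.im ^ 2 < 1 := by
    have hp : 0 < p := Fin.pos_iff_nonempty.2 hconn.nonempty
    rcases Nat.eq_or_lt_of_le hp with h | h
    · exact hone h.symm z h1 h2
    · have h4 := Network.lambdaMax_pos hconn h
      have h5 := hsamp z h1 h2 _ (Network.lambdaMax_mem_spectrum hp) h4.ne'
      rwa [div_self (pow_ne_zero 2 h4.ne')] at h5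
  simpa using (norm_sub_ofReal_lt_one_iff z 1).2 (by simpa using h3)

end Gains

/-! ### Runs of the tracking algorithm -/

section Runs

variable {p n v : ℕ} {net : Network p} {A : Matrix (Fin n) (Fin n) ℝ}

/-- The rows are the values of the nodes in channel `j`. -/
def channel {N : ℕ} (W : Fin p → Fin v → Fin N → ℝ) (j : Fin v) : Matrix (Fin p) (Fin N) ℝ :=
  Matrix.of fun i k => W i j k

theorem disagreement_apply {N : ℕ} (W : Fin p → Fin v → Fin N → ℝ) (i : Fin p) (j : Fin v)
    (k : Fin N) :
    net.disagreement i (fun l => W l.1) (W i) j k = -(net.laplacian * channel W j) i k := by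
  rw [Network.disagreement_eq]
  have : (net.laplacian * channel W j) i k = net.laplacian.mulVec (fun l => W l j k) i := rfl
  rw [this, Network.laplacian_mulVec_apply, ← Finset.sum_neg_distrib]
  simp only [Finset.sum_apply, Pi.smul_apply, Pi.sub_apply, smul_eq_mul]
  exact Finset.sum_congr rfl fun l _ => by ring

/-- The rows of the compression matrix give independent channels, each treated in matrix form. -/
theorem IsTrackingRun.tendsto (hconn : net.graph.Connected) (hsamp : SamplingCondition net A)
    (hone : p = 1 → ∀ μ : ℂ, IsEigenvalue A μ → 1 ≤ ‖μ‖ → (μ.re - 1) ^ 2 + μ.im ^ 2 < 1)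
    {φ W b η : ℕ → Fin p → Fin v → Fin (unstableDim A) → ℝ}
    (hrun : IsTrackingRun net (trackingMatrix A) net.integralGain 1 φ W b η)
    (hφ : ∀ i j, Tendsto (fun t => φ (t + 1) i j - (trackingMatrix A).mulVec (φ t i j)) atTop (𝓝 0))
    (i : Fin p) :
    Tendsto (fun t => (p : ℝ) • W t i - fun j k => ∑ l, φ t l j k) atTop (𝓝 0) := by
  rw [tendsto_pi_nhds]
  intro j
  have hη : ∀ t, channel (η t) j =
      channel (b t) j - net.integralGain • (net.laplacian * channel (W t) j) := by
    intro t
    ext i k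
    have h := congrFun (congrFun (hrun t i).2.2 j) k
    simp only [etaOf, one_smul, Pi.add_apply, Pi.smul_apply, disagreement_apply] at h
    rw [Matrix.sub_apply, Matrix.smul_apply]
    change η t i j k = b t i j k - _
    rw [h, smul_neg, sub_eq_add_neg]
  have hT : ∀ (M : Fin p → Fin v → Fin (unstableDim A) → ℝ) (i : Fin p) (k : Fin (unstableDim A)),
      (trackingMatrix A).mulVec (M i j) k = (channel M j * (trackingMatrix A).transpose) i k := by
    intro M i k
    simp only [Matrix.mulVec, dotProduct, Matrix.mul_apply, channel, Matrix.of_apply,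
      Matrix.transpose_apply, mul_comm]
  have key := tendsto_tracking (q := unstablePoly A) (N := unstableDim A) (k := net.integralGain)
    (W := fun t => channel (W t) j) (b := fun t => channel (b t) j)
    (φ := fun t => channel (φ t) j) hconn (unstablePoly_monic A) rfl
    (fun z hz => norm_sub_one_lt_one hconn hsamp hone hz)
    (fun l hl hl0 z hz => norm_sub_gain_lt_one hsamp hl hl0 hz) ?_ ?_ ?_
  · rw [tendsto_matrix_zero] at key
    refine (key i).congr fun t => ?_
    funext k
    change (p : ℝ) * W t i j k - ∑ l, 1 * φ t l j k = (p : ℝ) * W t i j k - ∑ l, φ t l j k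
    simp
  · intro t
    rw [← hη]
    ext i k
    have h := congrFun (congrFun (hrun t i).1 j) k
    simp only [nextW, Matrix.sub_mulVec, Matrix.one_mulVec, Pi.add_apply, Pi.sub_apply,
      Pi.smul_apply, disagreement_apply, hT] at h
    rw [Matrix.add_apply, Matrix.add_apply, Matrix.sub_apply, Matrix.smul_apply]
    change W (t + 1) i j k = _ - W t i j k + _ + φ t i j k
    rw [h, smul_neg, sub_neg_eq_add]
    rfl
  · intro t
    ext i k
    have h := congrFun (congrFun (hrun t i).2.1 j) k
    simp only [nextB, Pi.add_apply, Pi.smul_apply, disagreement_apply, hT] at h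
    rw [Matrix.sub_apply, Matrix.smul_apply]
    change b (t + 1) i j k = _
    rw [h, smul_neg, sub_eq_add_neg]
    rfl
  · rw [tendsto_matrix_zero]
    intro i
    refine (hφ i j).congr fun t => ?_
    funext k
    rw [Pi.sub_apply, hT]
    rfl

/-- Tracking followed by reconstruction: if the inputs of the nodes outside a small set `S` are the
stacked outputs of the trajectory, sampled at the times `τ t`, and all inputs follow the tracking
dynamics up to a vanishing error, then the reconstructed states approach the trajectory. -/
theorem IsTrackingRun.tendsto_reconstruction {s : ℕ} {C : Matrix (Fin p) (Fin n) ℝ}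
    {D : Matrix (Fin v) (Fin p) ℝ} (hconn : net.graph.Connected) (hsamp : SamplingCondition net A)
    (hone : p = 1 → ∀ μ : ℂ, IsEigenvalue A μ → 1 ≤ ‖μ‖ → (μ.re - 1) ^ 2 + μ.im ^ 2 < 1)
    (hD : SparseDetectableWrt A C D (2 * s))
    {Φ : ℕ → Fin p → Fin (unstableDim A) → ℝ} {W b η : ℕ → Fin p → Fin v → Fin (unstableDim A) → ℝ}
    (hrun : IsTrackingRun net (trackingMatrix A) net.integralGain 1
      (fun t i j => D j i • Φ t i) W b η)
    (hΦ : ∀ i, Tendsto (fun t => Φ (t + 1) i - (trackingMatrix A).mulVec (Φ t i)) atTop (𝓝 0))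
    {x : ℕ → Fin n → ℝ} (hx : IsTrajectory A x) {τ : ℕ → ℕ} (hτ : Tendsto τ atTop atTop)
    {S : Finset (Fin p)} (hS : S.card ≤ s)
    (hΦS : ∀ᶠ t in atTop, ∀ i ∉ S, ∀ k, Φ t i k = (C * A ^ (k : ℕ)).mulVec (x (τ t)) i)
    {z : ℕ → Fin n → ℝ} {i : Fin p} (hz : ∀ t, IsReconstruction A C D s (W t i) (z t)) :
    Tendsto (fun t => z t - x (τ t)) atTop (𝓝 0) := by
  classical
  obtain ⟨u, r, hu, hr, hur⟩ := hx.exists_decomposition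
  have h1 := hrun.tendsto hconn hsamp hone (fun i j => by
    have h2 := (hΦ i).const_smul (D j i)
    rw [smul_zero] at h2
    refine h2.congr fun t => ?_
    rw [smul_sub, Matrix.mulVec_smul]) i
  have h2 := DSST.tendsto_reconstruction hD (z := z) (u := fun t => u (τ t)) (r := fun t => r (τ t))
    (W := fun t => W t i)
    (E := fun t i k => if i ∈ S then Φ t i k - (C * A ^ (k : ℕ)).mulVec (x (τ t)) i else 0)
    hz (fun t => hu _) (hr.comp hτ)
    (fun t => blockSparse_iff.2 ⟨S, hS, fun i hi => by funext k; simp [hi]⟩) ?_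
  · simpa only [← hur] using h2
  · refine h1.congr' ?_
    filter_upwards [hΦS] with t ht
    congr 1
    funext j k
    simp only [compressed, ← hur, Pi.smul_apply, smul_eq_mul]
    refine Finset.sum_congr rfl fun l _ => ?_
    split_ifs with hl
    · ring
    · rw [ht l hl k, add_zero]

end Runs

/-! ### The decentralized algorithm -/

/-- The bound on `t + k` says that the initial contents of the buffer have left position `k`. -/
theorem shiftIn_iterate {m : ℕ} {u : ℕ → Fin m → ℝ} {Y : ℕ → ℝ}
    (h : ∀ t, u (t + 1) = shiftIn (u t) (Y t)) (t : ℕ) (k : Fin m) (hk : m ≤ t + k) :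
    u t k = Y (t + k - m) := by
  induction t generalizing k with
  | zero => have := k.2; omega
  | succ t ih =>
    rw [h, shiftIn]
    split_ifs with h1
    · rw [ih ⟨k + 1, h1⟩ (by simp; omega)]
      congr 1
      simp
      omega
    · congr 1
      have := k.2
      omega

section Algorithm

variable {p n v : ℕ} {net : Network p} {A : Matrix (Fin n) (Fin n) ℝ}
  {D : Matrix (Fin v) (Fin p) ℝ} {kI kP : ℝ} {W0 b0 : Fin p → Fin v → Fin (unstableDim A) → ℝ}
  {recon : Fin p → (Fin v → Fin (unstableDim A) → ℝ) → Fin n → ℝ} {y : ℕ → Fin p → ℝ}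

variable (net A D kI kP W0 b0 recon y) in
/-- The memory of node `i` at the beginning of sampling period `t`. -/
noncomputable def memory (t : ℕ) (i : Fin p) : Memory n (unstableDim A) v :=
  (trackingAlgorithm net A D kI kP W0 b0 recon).run y t i

local notation "σ" => memory net A D kI kP W0 b0 recon y

theorem memory_time (t : ℕ) (i : Fin p) : (σ t i).time = t := by
  induction t with
  | zero => rfl
  | succ t ih =>
    have : (σ (t + 1) i).time = (σ t i).time + 1 := rfl
    rw [this, ih]

theorem memory_past (t : ℕ) (ht : n ≤ t) (i : Fin p) : (σ t i).past = window n y (t - n) i := by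
  funext k
  rw [shiftIn_iterate (u := fun t => (σ t i).past) (Y := fun t => y t i) (fun t => rfl) t k
    (by omega), window]
  congr 1
  omega

theorem memory_recent (t : ℕ) (ht : unstableDim A - 1 ≤ t) (i : Fin p) :
    (σ (t + 1) i).recent = window (unstableDim A) y (t - (unstableDim A - 1)) i := by
  funext k
  have := k.2
  rw [shiftIn_iterate (u := fun t => (σ t i).recent) (Y := fun t => y t i) (fun t => rfl) (t + 1) k
    (by omega), window]
  congr 1
  omega

theorem memory_clean_succ (t : ℕ) (i : Fin p) :
    (σ (t + 1) i).clean ↔ (σ t i).clean ∧ (n ≤ t →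
      window n y (t - n + 1) i = (companion n A.charpoly).mulVec (window n y (t - n) i)) := by
  have h : (σ (t + 1) i).clean = ((σ t i).clean ∧ (n ≤ (σ t i).time →
    (σ (t + 1) i).past = (companion n A.charpoly).mulVec (σ t i).past)) := rfl
  rw [h, memory_time]
  refine and_congr_right fun _ => forall_congr' fun ht => ?_
  rw [memory_past t ht, memory_past (t + 1) (by omega), show t + 1 - n = t - n + 1 by omega]

theorem memory_clean_iff (i : Fin p) :
    (∀ t, (σ t i).clean) ↔ PassesSanityCheck A y i := by
  constructor
  · intro h t
    have := ((memory_clean_succ (t + n) i).1 (h (t + n + 1))).2 (by omega)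
    rwa [show t + n - n = t by omega] at this
  · intro h t
    induction t with
    | zero => exact trivial
    | succ t ih => exact (memory_clean_succ t i).2 ⟨ih, fun _ => h _⟩

theorem memory_clean_anti {t t' : ℕ} (htt' : t ≤ t') (i : Fin p) (h : (σ t' i).clean) :
    (σ t i).clean := by
  induction t', htt' using Nat.le_induction with
  | base => exact h
  | succ t' _ ih => exact ih ((memory_clean_succ t' i).1 h).1

open Classical in
variable (net A D kI kP W0 b0 recon y) in
/-- The stack of measurements that node `i` uses in period `t`. -/
noncomputable def usedStack (t : ℕ) (i : Fin p) : Fin (unstableDim A) → ℝ :=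
  -- The index is t + 1 because sensing opens period t and the exchanges leave these fields
  -- untouched.
  if (σ (t + 1) i).clean then (σ (t + 1) i).recent else 0

theorem isTrackingRun_memory :
    IsTrackingRun net (trackingMatrix A) kI kP
      (fun t i j => D j i • usedStack net A D kI kP W0 b0 recon y t i)
      (fun t i => (σ t i).W) (fun t i => (σ t i).b)
      (fun t i => etaOf kI kP (σ t i).b
        (net.disagreement i (fun l => (σ t l.1).W) (σ t i).W)) := by
  intro t i
  refine ⟨?_, rfl, rfl⟩
  have h : (σ (t + 1) i).W = nextW (trackingMatrix A) kI (σ t i).W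
      (net.disagreement i (fun l => etaOf kI kP (σ t l.1).b
        (net.disagreement l.1 (fun m => (σ t m.1).W) (σ t l.1).W))
        (etaOf kI kP (σ t i).b (net.disagreement i (fun l => (σ t l.1).W) (σ t i).W)))
      ((σ (t + 1) i).input fun j => D j i) := rfl
  refine h.trans ?_
  congr 1
  funext j
  simp only [Memory.input, usedStack]
  split_ifs <;> simp

theorem estimate_trackingAlgorithm (t : ℕ) (i : Fin p) :
    (trackingAlgorithm net A D kI kP W0 b0 recon).estimate y t i =
      (A ^ (unstableDim A - 1)).mulVec (recon i (σ t i).W) := rfl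

theorem usedStack_of_passes {i : Fin p} (h : PassesSanityCheck A y i) {t : ℕ}
    (ht : unstableDim A - 1 ≤ t) : usedStack net A D kI kP W0 b0 recon y t i =
      window (unstableDim A) y (t - (unstableDim A - 1)) i := by
  rw [usedStack, if_pos ((memory_clean_iff i).2 h _), memory_recent t ht]

/-- Either the check is always passed and the stacks are delayed windows, or it fails once and for
all and the input is eventually 0. -/
theorem tendsto_usedStack (hn : 0 < n) (i : Fin p) :
    Tendsto (fun t => usedStack net A D kI kP W0 b0 recon y (t + 1) i -
      (trackingMatrix A).mulVec (usedStack net A D kI kP W0 b0 recon y t i)) atTop (𝓝 0) := by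
  by_cases h : PassesSanityCheck A y i
  · refine ((tendsto_window_of_passesSanityCheck hn h).comp
      (tendsto_sub_atTop_nat (unstableDim A - 1))).congr' ?_
    filter_upwards [eventually_ge_atTop (unstableDim A - 1)] with t ht
    rw [usedStack_of_passes h ht, usedStack_of_passes h (by omega : unstableDim A - 1 ≤ t + 1),
      Function.comp_apply, show t + 1 - (unstableDim A - 1) = t - (unstableDim A - 1) + 1 by omega]
  · rw [← memory_clean_iff (net := net) (D := D) (kI := kI) (kP := kP) (W0 := W0) (b0 := b0)
      (recon := recon)] at h
    push Not at h
    obtain ⟨T, hT⟩ := h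
    have h0 : ∀ t, T ≤ t + 1 → usedStack net A D kI kP W0 b0 recon y t i = 0 := fun t ht =>
      if_neg fun hc => hT (memory_clean_anti ht i hc)
    refine tendsto_const_nhds.congr' ?_
    filter_upwards [eventually_ge_atTop T] with t ht
    rw [h0 t (by omega), h0 (t + 1) (by omega), Matrix.mulVec_zero, sub_zero]

end Algorithm

theorem window_measurement_of_no_attack {p n N : ℕ} {A : Matrix (Fin n) (Fin n) ℝ}
    {C : Matrix (Fin p) (Fin n) ℝ} {x : ℕ → Fin n → ℝ} (hx : IsTrajectory A x)
    {e : ℕ → Fin p → ℝ} {i : Fin p} (he : ∀ t, e t i = 0) (t : ℕ) (k : Fin N) :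
    window N (measurement C x e) t i k = (C * A ^ (k : ℕ)).mulVec (x t) i := by
  rw [window, measurement, he, add_zero, hx.add, Matrix.mulVec_mulVec]

theorem trackingAlgorithm_solves {p n v s : ℕ} {net : Network p} {A : Matrix (Fin n) (Fin n) ℝ}
    {C : Matrix (Fin p) (Fin n) ℝ} {D : Matrix (Fin v) (Fin p) ℝ} (hn : 0 < n)
    (hconn : net.graph.Connected) (hsamp : SamplingCondition net A)
    (hone : p = 1 → ∀ μ : ℂ, IsEigenvalue A μ → 1 ≤ ‖μ‖ → (μ.re - 1) ^ 2 + μ.im ^ 2 < 1)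
    (hD : SparseDetectableWrt A C D (2 * s)) (W0 b0 : Fin p → Fin v → Fin (unstableDim A) → ℝ)
    {recon : Fin p → (Fin v → Fin (unstableDim A) → ℝ) → Fin n → ℝ}
    (hrecon : ∀ i W, IsReconstruction A C D s W (recon i W)) :
    (trackingAlgorithm net A D net.integralGain 1 W0 b0 recon).Solves A C s := by
  intro x e hx ⟨S, hS, he⟩ i
  set d := unstableDim A - 1 with hd
  rw [← tendsto_zero_iff_norm_tendsto_zero]
  have h1 := (isTrackingRun_memory (net := net) (A := A) (D := D) (kI := net.integralGain) (kP := 1)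
    (W0 := W0) (b0 := b0) (recon := recon)
    (y := measurement C x e)).tendsto_reconstruction hconn hsamp hone hD (tendsto_usedStack hn)
    hx (tendsto_sub_atTop_nat d) hS ?_ (i := i) (fun t => hrecon i _)
  · have h2 : Continuous fun z : Fin n → ℝ => (A ^ d).mulVec z :=
      continuous_const.matrix_mulVec continuous_id
    have h3 := (h2.tendsto 0).comp h1
    rw [Matrix.mulVec_zero] at h3
    refine h3.congr' ?_
    filter_upwards [eventually_ge_atTop d] with t ht
    -- The reconstruction approaches the state `d` steps in the past; `A ^ d` brings both it and its
    -- error to the present, and the fixed matrix keeps the error null.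
    have h4 := hx.add (t - d) d
    rw [Nat.sub_add_cancel ht] at h4
    rw [Function.comp_apply, Matrix.mulVec_sub, ← h4, estimate_trackingAlgorithm]
  · filter_upwards [eventually_ge_atTop d] with t ht l hl k
    rw [usedStack_of_passes (passesSanityCheck_of_no_attack hx fun t => he t l hl) ht,
      window_measurement_of_no_attack hx fun t => he t l hl]

end DSST

theorem mainTheorem3 {p n s : ℕ} (net : DSST.Network p)
    (A : Matrix (Fin n) (Fin n) ℝ) (C : Matrix (Fin p) (Fin n) ℝ)
    (hconn : net.graph.Connected)
    (hsamp : DSST.SamplingCondition net A)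
    (hone : p = 1 → ∀ μ : ℂ, DSST.IsEigenvalue A μ → 1 ≤ ‖μ‖ → (μ.re - 1) ^ 2 + μ.im ^ 2 < 1)
    (hdet : DSST.SparseDetectable A C (2 * s)) :
    -- the identity is an admissible compression matrix
    DSST.SparseDetectableWrt A C (1 : Matrix (Fin p) (Fin p) ℝ) (2 * s) ∧
    ∃ kI kP : ℝ, ∀ (v : ℕ) (D : Matrix (Fin v) (Fin p) ℝ),
      DSST.SparseDetectableWrt A C D (2 * s) →
      -- the reconstruction problem always has a solution
      (∀ W : Fin v → Fin (DSST.unstableDim A) → ℝ, ∃ z : Fin n → ℝ,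
        DSST.IsReconstruction A C D s W z) ∧
      -- if all measurements pass the local sanity check, tracking and reconstruction yield the state
      (∀ (x : ℕ → Fin n → ℝ) (e : ℕ → Fin p → ℝ),
        DSST.IsTrajectory A x → DSST.IsAttack s e →
        (∀ i, DSST.PassesSanityCheck A (DSST.measurement C x e) i) →
        ∀ W b η : ℕ → Fin p → Fin v → Fin (DSST.unstableDim A) → ℝ,
          DSST.IsTrackingRun net (DSST.trackingMatrix A) kI kP
            (fun t i j => D j i • DSST.window (DSST.unstableDim A) (DSST.measurement C x e) t i)
            W b η →
          ∀ xhat : ℕ → Fin p → Fin n → ℝ,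
            (∀ t i, DSST.IsReconstruction A C D s (W t i) (xhat t i)) →
            ∀ i, Filter.Tendsto (fun t => ‖xhat t i - x t‖) Filter.atTop (nhds 0)) ∧
      -- the resulting decentralized algorithm solves the tracking problem for arbitrary attacks
      (∀ (W0 b0 : Fin p → Fin v → Fin (DSST.unstableDim A) → ℝ)
        (recon : Fin p → (Fin v → Fin (DSST.unstableDim A) → ℝ) → Fin n → ℝ),
        (∀ i W, DSST.IsReconstruction A C D s W (recon i W)) →
        (DSST.trackingAlgorithm net A D kI kP W0 b0 recon).Solves A C s) := by

  refine ⟨hdet.wrt_one, net.integralGain, 1, fun v D hD =>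
    ⟨DSST.exists_isReconstruction, ?_, ?_⟩⟩
  · intro x e hx ⟨S, hS, he⟩ hpass W b η hrun xhat hxhat i
    -- In dimension 0 the check carries no information, but there is nothing to estimate.
    rcases Nat.eq_zero_or_pos n with rfl | hn
    · exact tendsto_const_nhds.congr fun t => by
        rw [Subsingleton.elim (xhat t i - x t) 0, norm_zero]
    rw [← tendsto_zero_iff_norm_tendsto_zero]
    refine hrun.tendsto_reconstruction hconn hsamp hone hD
      (fun i => DSST.tendsto_window_of_passesSanityCheck hn (hpass i)) hx Filter.tendsto_id hS
      (Filter.Eventually.of_forall fun t l hl k => ?_) (fun t => hxhat t i)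
    exact DSST.window_measurement_of_no_attack hx (fun t => he t l hl) t k
  · intro W0 b0 recon hrecon
    rcases Nat.eq_zero_or_pos n with rfl | hn
    · intro x e _ _ i
      exact tendsto_const_nhds.congr fun t => by
        rw [Subsingleton.elim (DSST.Algorithm.estimate _ _ t i - x t) 0, norm_zero]
    · exact DSST.trackingAlgorithm_solves hn hconn hsamp hone hD W0 b0 hrecon
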